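/- **Setting.** Let $d\ge 1$, let $h_0,\dots,h_d$ be layer sizes, $K=h_d\ge 2$ the number of classes, $h=\max_{0\le l\le d}h_l$ the width and $B\ge 0$. For weights $w=(W_1,\dots,W_d)$, $W_l\in\mathbb R^{h_l\times h_{l-1}}$, let $f_w(x)=W_d\,\phi(W_{d-1}\phi(\cdots\phi(W_1x)))$, where $\phi$ is the coordinatewise ReLU. Let $\|\cdot\|_2$ and $\|\cdot\|_F$ be the spectral and Frobenius norms, $\|w\|_2^2=\sum_l\|W_l\|_F^2$ and $$\Phi(w)=\prod_{l=1}^d\|W_l\|_2^2\;\sum_{l=1}^d\frac{\|W_l\|_F^2}{\|W_l\|_2^2}$$ (with the convention $0/0=0$). For $\gamma\ge0$, a probability distribution $\mathcal D$ of labelled examples $(x,y)$ with $\|x\|_2\le B$ almost surely, and an i.i.d. sample of size $m\ge1$ from $\mathcal D$, let $L_\gamma(f_w)=\mathbb P_{(x,y)\sim\mathcal D}\big(f_w(x)[y]\le\gamma+\max_{j\ne y}f_w(x)[j]\big)$, and let $\hat L_\gamma(f_w)$ be the corresponding average over the sample. For $\gamma>0$ put $\kappa=1+2\ln2+\sqrt{4\ln2}$,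 $\eta^2=16\kappa\|w\|_2^2/\gamma^2$ and, for each layer $l$, $$A_l=e\sqrt d\,B\,\frac{\prod_i\|W_i\|_2}{\|W_l\|_2}\,I,\qquad R_l^*=(I+\eta^2A_l^{\mathsf T}A_l)^{-1},\qquad R^*=\mathrm{blkdiag}(R_1^*,\dots,R_d^*),$$ where $A_l$ and $R^*_l$ act on vectorized matrices in $\mathbb R^{h_l\times h_{l-1}}$. **Theorem.** There is an absolute constant $C>0$ such that the following hold for all $d$, $(h_l)$, $B$ as above and all $\gamma>0$. (a) Suppose that $\|W_l\|_2=\beta$ for all $l$, $\gamma\le 2B\beta^d$, and $|\beta-\hat\beta|\le\beta/d$. Define $\sigma^2$ by $\frac1{\sigma^2}=\frac{16e^2\kappa}{\gamma^2}\sum_l\mathrm{Tr}(\hat A_l\hat A_l^{\mathsf T})$ with $\hat A_l=e\sqrt d\,B\hat\beta^{\,d-1}I$. Then for $u\sim\mathcal N(0,\sigma^2R^*)$, with probability at least $\frac12$, $$\sum_l\|A_lu_l\|_2^2<\frac{\gamma^2}{16}\quad\text{and}\quad\|f_{w+u}(x)-f_w(x)\|_\infty^2\le\sum_l\|A_lu_l\|_2^2\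 \text{ for all } x \text{ with } \|x\|_2\le B,$$ and $$D_{\mathrm{KL}}\big(\mathcal N(w,\sigma^2R^*)\,\|\,\mathcal N(0,\sigma^2I)\big)\le C\,\frac{B^2d^2h^2\Phi(w)}{\gamma^2}.$$ (b) For every distribution $\mathcal D$ as above, every $m\ge1$ and every $\delta>0$, with probability at least $1-\delta$ over the sample, for every $w$, $$L_0(f_w)\le\hat L_\gamma(f_w)+C\sqrt{\frac{B^2d^2h^2\Phi(w)+\max(1,\gamma^2)\ln\frac{dm}{\delta}}{\gamma^2m}}.$$ In particular, for $\gamma\le1$, $$L_0(f_w)\le\hat L_\gamma(f_w)+C\sqrt{\frac{B^2d^2h^2\Phi(w)+\ln\frac{dm}{\delta}}{\gamma^2m}}.$$ -/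

import Mathlib

open MeasureTheory ProbabilityTheory InformationTheory

open scoped Matrix ENNReal

noncomputable section

namespace PacBayesNet

/-! ### Networks

`s k` is the number of units of layer `k`, for `0 ≤ k ≤ d`; layer `0` is the input and layer `d` the
output, so the input dimension is `s 0` and the number of classes is `s d`. -/

/-- The weight matrices of a depth-`d` feedforward network with layer sizes `s`; the entry with
(zero-based) index `l` maps layer `l` to layer `l + 1`. -/
abbrev Weights (d : ℕ) (s : ℕ → ℕ) : Type :=
  (l : Fin d) → Matrix (Fin (s (l + 1))) (Fin (s l)) ℝ

/-- The ReLU activation function. -/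
def relu (t : ℝ) : ℝ := max t 0

/-- The pre-activation values of layer `k`: the input `x` itself at `k = 0`, then `W₁ x`, and then
`W_{k+1} φ(·)` of the values of the layer below, with `φ` the coordinatewise ReLU. -/
def preact {d : ℕ} {s : ℕ → ℕ} (W : Weights d s) (x : EuclideanSpace ℝ (Fin (s 0))) :
    (k : ℕ) → k ≤ d → Fin (s k) → ℝ
  | 0, _ => fun i => x i
  | 1, hk => W ⟨0, hk⟩ *ᵥ (fun i => x i)
  | k + 2, hk => W ⟨k + 1, hk⟩ *ᵥ (fun i => relu (preact W x (k + 1) (Nat.le_of_succ_le hk) i))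

/-- The network `f_w(x) = W_d φ(W_{d-1} φ(⋯ φ(W₁ x)))`. -/
def net {d : ℕ} {s : ℕ → ℕ} (W : Weights d s) (x : EuclideanSpace ℝ (Fin (s 0))) :
    Fin (s d) → ℝ :=
  preact W x d le_rfl

/-- The width: the largest number of units in a layer. -/
def width (d : ℕ) (s : ℕ → ℕ) : ℕ := (Finset.range (d + 1)).sup s

/-! ### Norms and the spectral complexity -/

open scoped Matrix.Norms.L2Operator in
/-- The spectral norm of a matrix (operator norm between Euclidean spaces). -/
def specNorm {a b : ℕ} (M : Matrix (Fin a) (Fin b) ℝ) : ℝ := ‖M‖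

/-- The Frobenius norm of a matrix. -/
def frobNorm {a b : ℕ} (M : Matrix (Fin a) (Fin b) ℝ) : ℝ := √(∑ i, ∑ j, M i j ^ 2)

/-- The squared Euclidean norm of the vector of all weights. -/
def weightNormSq {d : ℕ} {s : ℕ → ℕ} (W : Weights d s) : ℝ := ∑ l, frobNorm (W l) ^ 2

/-- The spectral complexity `Φ(w) = ∏ ‖W_l‖₂² ∑ ‖W_l‖_F² / ‖W_l‖₂²`. -/
def spectralComplexity {d : ℕ} {s : ℕ → ℕ} (W : Weights d s) : ℝ :=
  (∏ l, specNorm (W l) ^ 2) * ∑ l, frobNorm (W l) ^ 2 / specNorm (W l) ^ 2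

/-! ### Margin losses -/

/-- The margin loss of a score vector `v` with true label `y`: the indicator of
`v y ≤ γ + max_{j ≠ y} v j`. -/
def marginLoss {K : ℕ} (γ : ℝ) (v : Fin K → ℝ) (y : Fin K) : ℝ :=
  open scoped Classical in
  if v y ≤ γ + ⨆ j : {j : Fin K // j ≠ y}, v j then 1 else 0

/-- The expected margin loss `L_γ(f_w)` under the distribution `D` of labelled examples. -/
def expectedLoss {d : ℕ} {s : ℕ → ℕ}
    (D : Measure (EuclideanSpace ℝ (Fin (s 0)) × Fin (s d))) (γ : ℝ) (W : Weights d s) : ℝ :=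
  ∫ p, marginLoss γ (net W p.1) p.2 ∂D

/-- The empirical margin loss on the sample `S` of size `m`. -/
def empiricalLoss {d m : ℕ} {s : ℕ → ℕ}
    (S : Fin m → EuclideanSpace ℝ (Fin (s 0)) × Fin (s d)) (γ : ℝ) (W : Weights d s) : ℝ :=
  (∑ i, marginLoss γ (net W (S i).1) (S i).2) / m

/-! ### Gaussian perturbations, sensitivity matrices and posterior -/

/-- The index set of the vectorized weights of layer `l`. -/
abbrev LayerIndex (s : ℕ → ℕ) (l : ℕ) : Type := Fin (s (l + 1)) × Fin (s l)

/-- Weights in vectorized form, layer by layer. -/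
abbrev WeightVec (d : ℕ) (s : ℕ → ℕ) : Type :=
  (l : Fin d) → EuclideanSpace ℝ (LayerIndex s l)

/-- Vectorization of the weight matrices. -/
def vec {d : ℕ} {s : ℕ → ℕ} (W : Weights d s) : WeightVec d s :=
  fun l => WithLp.toLp 2 (fun p => W l p.1 p.2)

/-- The weight matrices with given vectorization. -/
def unvec {d : ℕ} {s : ℕ → ℕ} (u : WeightVec d s) : Weights d s :=
  fun l => Matrix.of (fun i j => u l (i, j))

/-- A family of square matrices, one for each layer, acting on the vectorized weights. -/
abbrev LayerMatrices (d : ℕ) (s : ℕ → ℕ) : Type :=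
  (l : Fin d) → Matrix (LayerIndex s l) (LayerIndex s l) ℝ

/-- The Gaussian law `N(μ, Σ)` with block-diagonal covariance `Σ = blkdiag(Σ₁, …, Σ_d)`. -/
def blockGaussian {d : ℕ} {s : ℕ → ℕ} (μ : WeightVec d s) (cov : LayerMatrices d s) :
    Measure (WeightVec d s) :=
  Measure.pi (fun l => multivariateGaussian (μ l) (cov l))

/-- `∑_l ‖A_l u_l‖₂²`. -/
def blockNormSq {d : ℕ} {s : ℕ → ℕ} (A : LayerMatrices d s) (u : WeightVec d s) : ℝ :=
  ∑ l, ∑ p, (A l *ᵥ (fun q => u l q)) p ^ 2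

/-- The diagonal sensitivity matrices `A_l = e √d B (∏_i ‖W_i‖₂ / ‖W_l‖₂) I`. -/
def sensitivity {d : ℕ} {s : ℕ → ℕ} (B : ℝ) (W : Weights d s) : LayerMatrices d s :=
  fun l => (Real.exp 1 * √d * B * (∏ i, specNorm (W i)) / specNorm (W l)) • 1

/-- The same matrices for layers that all have spectral norm `β`: `e √d B β^(d-1) I`. -/
def sensitivityOfNorm {d : ℕ} {s : ℕ → ℕ} (B β : ℝ) : LayerMatrices d s :=
  fun _ => (Real.exp 1 * √d * B * β ^ (d - 1)) • 1

/-- The constant `κ = 1 + 2 ln 2 + √(4 ln 2)`. -/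
def kappa : ℝ := 1 + 2 * Real.log 2 + √(4 * Real.log 2)

/-- `η² = 16 κ ‖w‖₂² / γ²`. -/
def etaSq {d : ℕ} {s : ℕ → ℕ} (γ : ℝ) (W : Weights d s) : ℝ :=
  16 * kappa * weightNormSq W / γ ^ 2

/-- The optimized posterior covariance `R_l* = (I + η² A_lᵀ A_l)⁻¹`, up to the factor `σ²`. -/
def optCov {d : ℕ} {s : ℕ → ℕ} (B γ : ℝ) (W : Weights d s) : LayerMatrices d s :=
  fun l => (1 + etaSq γ W • ((sensitivity B W l)ᵀ * sensitivity B W l))⁻¹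

/-- The prior variance `σ²` chosen from an approximation `βhat` of the common spectral norm:
`1 / σ² = (16 e² κ / γ²) ∑_l Tr(Â_l Â_lᵀ)`, where `Â_l` is `A_l` with `βhat` as spectral norm. -/
def priorVar (d : ℕ) (s : ℕ → ℕ) (B γ βhat : ℝ) : ℝ :=
  (16 * Real.exp 1 ^ 2 * kappa / γ ^ 2 *
    ∑ l : Fin d, (sensitivityOfNorm (s := s) B βhat l *
      (sensitivityOfNorm (s := s) B βhat l)ᵀ).trace)⁻¹

/-- The Gaussian prior `N(0, σ² I)`. -/
def prior (d : ℕ) (s : ℕ → ℕ) (var : ℝ) : Measure (WeightVec d s) :=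
  blockGaussian 0 (fun _ => var • 1)

/-- The law `N(0, σ² R*)` of the weight perturbation `u`. -/
def perturbationLaw {d : ℕ} {s : ℕ → ℕ} (B γ var : ℝ) (W : Weights d s) :
    Measure (WeightVec d s) :=
  blockGaussian 0 (fun l => var • optCov B γ W l)

/-- The Gaussian posterior `N(w, σ² R*)`, the law of `w + u`. -/
def posterior {d : ℕ} {s : ℕ → ℕ} (B γ var : ℝ) (W : Weights d s) :
    Measure (WeightVec d s) :=
  blockGaussian (vec W) (fun l => var • optCov B γ W l)

end PacBayesNet

end

noncomputable section

namespace PacBayesNet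

open scoped NNReal

/-! ### Euclidean, spectral and Frobenius norms -/

/-! Both parts rest on one deterministic estimate, `euclNorm_net_sub_le`: ReLU is 1-Lipschitz and
vanishes at 0, so layer-by-layer telescoping bounds the change of the output by `∏ (b + r_l) - ∏ b`,
hence by an exponential of the sum of the relative perturbations.

Part (a). When all layers have spectral norm `β`, every sensitivity matrix is the same scalar `a`,
so posterior and prior are isotropic Gaussians. With `N` weights, the prior variance `v` makes `a² N
v` at most `γ² / (16 κ)`, because replacing `β` by `βhat` costs at most a factor `e` in the power `d
- 1`. As `κ ≥ 2`, Markov's inequality already yields probability 1/2. On this event `γ ≤ 2 B β^d`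
makes the relative perturbations sum to at most 1, where `exp t - 1 ≤ e t` linearizes the estimate,
and Cauchy-Schwarz gives the factor `√d`. The divergence is bounded coordinate by coordinate; the
mean shift and the covariance change both contribute a multiple of `B² d β^(2d-2) ‖w‖² N / γ²`, and
`N ≤ d h²`.

Part (b) does not go through the Gaussian posterior. It is an Occam bound: Hoeffding's inequality
and a union bound over countably many lattice networks, weighted by a geometric prior
(`exists_forall_integral_le_average_add`). By homogeneity each layer of `w` may be scaled to
spectral norm 1, with `γ` divided by the product `c` of the norms. Rounding the scaled weights to a
mesh of order `γ / (B c d h)` changes the scores by less than the margin permits, so the loss of the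
rounded network lies between the losses of `w` at margins 0 and `γ` (`exists_latticeIndex`). The
description length is controlled by the sum of squares of the rounded integers, that is by squared
Frobenius norms over squared mesh, which is of order `B² d² h² Φ(w) / γ²`. If `γ ≥ 2 B c`, the
empirical loss is 1 and the bound is trivial. -/

/-- The Euclidean norm of a tuple of reals. -/
def euclNorm {n : ℕ} (v : Fin n → ℝ) : ℝ := ‖WithLp.toLp 2 v‖

lemma euclNorm_sq {n : ℕ} (v : Fin n → ℝ) : euclNorm v ^ 2 = ∑ i, v i ^ 2 := by
  simp [euclNorm, EuclideanSpace.real_norm_sq_eq]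

lemma euclNorm_nonneg {n : ℕ} (v : Fin n → ℝ) : 0 ≤ euclNorm v := norm_nonneg _

lemma euclNorm_add_le {n : ℕ} (v w : Fin n → ℝ) : euclNorm (v + w) ≤ euclNorm v + euclNorm w := by
  simpa [euclNorm] using norm_add_le (WithLp.toLp 2 v) (WithLp.toLp 2 w)

lemma abs_apply_le_euclNorm {n : ℕ} (v : Fin n → ℝ) (i : Fin n) : |v i| ≤ euclNorm v := by
  simpa [euclNorm] using PiLp.norm_apply_le (WithLp.toLp 2 v) i

lemma euclNorm_le_of_sq_le {n : ℕ} {v w : Fin n → ℝ} (h : ∀ i, v i ^ 2 ≤ w i ^ 2) :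
    euclNorm v ≤ euclNorm w := by
  refine le_of_sq_le_sq ?_ (euclNorm_nonneg w)
  rw [euclNorm_sq, euclNorm_sq]
  exact Finset.sum_le_sum fun i _ => h i

lemma specNorm_nonneg {a b : ℕ} (M : Matrix (Fin a) (Fin b) ℝ) : 0 ≤ specNorm M := by
  open scoped Matrix.Norms.L2Operator in
  exact norm_nonneg M

lemma frobNorm_nonneg {a b : ℕ} (M : Matrix (Fin a) (Fin b) ℝ) : 0 ≤ frobNorm M :=
  Real.sqrt_nonneg _

lemma frobNorm_sq {a b : ℕ} (M : Matrix (Fin a) (Fin b) ℝ) :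
    frobNorm M ^ 2 = ∑ i, ∑ j, M i j ^ 2 :=
  Real.sq_sqrt (by positivity)

open scoped Matrix.Norms.L2Operator in
lemma euclNorm_mulVec_le {a b : ℕ} (M : Matrix (Fin a) (Fin b) ℝ) (v : Fin b → ℝ) :
    euclNorm (M *ᵥ v) ≤ specNorm M * euclNorm v := by
  simpa [euclNorm, specNorm] using Matrix.l2_opNorm_mulVec M (WithLp.toLp 2 v)

open scoped Matrix.Norms.L2Operator in
lemma specNorm_add_le {a b : ℕ} (M N : Matrix (Fin a) (Fin b) ℝ) :
    specNorm (M + N) ≤ specNorm M + specNorm N :=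
  norm_add_le M N

open scoped Matrix.Norms.L2Operator in
lemma specNorm_smul {a b : ℕ} (c : ℝ) (M : Matrix (Fin a) (Fin b) ℝ) :
    specNorm (c • M) = |c| * specNorm M :=
  norm_smul c M

lemma frobNorm_smul {a b : ℕ} (c : ℝ) (M : Matrix (Fin a) (Fin b) ℝ) :
    frobNorm (c • M) = |c| * frobNorm M := by
  rw [← sq_eq_sq₀ (frobNorm_nonneg _) (mul_nonneg (abs_nonneg c) (frobNorm_nonneg _)), mul_pow,
    frobNorm_sq, frobNorm_sq, sq_abs]
  simp [mul_pow, Finset.mul_sum]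

open scoped Matrix.Norms.L2Operator in
lemma specNorm_le_frobNorm {a b : ℕ} (M : Matrix (Fin a) (Fin b) ℝ) :
    specNorm M ≤ frobNorm M := by
  rw [specNorm, Matrix.l2_opNorm_def]
  refine ContinuousLinearMap.opNorm_le_bound _ (frobNorm_nonneg M) fun x => ?_
  refine le_of_sq_le_sq ?_ (mul_nonneg (frobNorm_nonneg M) (norm_nonneg x))
  rw [mul_pow, frobNorm_sq, EuclideanSpace.real_norm_sq_eq, EuclideanSpace.real_norm_sq_eq,
    Finset.sum_mul]
  refine Finset.sum_le_sum fun i _ => ?_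
  simpa [Matrix.mulVec, dotProduct] using
    Finset.sum_mul_sq_le_sq_mul_sq Finset.univ (fun j => M i j) (fun j => x j)

lemma frobNorm_le_of_abs_le {a b : ℕ} {M : Matrix (Fin a) (Fin b) ℝ} {r : ℝ} {h : ℕ}
    (ha : a ≤ h) (hb : b ≤ h) (hr : 0 ≤ r) (hM : ∀ i j, |M i j| ≤ r) : frobNorm M ≤ r * h := by
  refine le_of_sq_le_sq ?_ (by positivity)
  rw [frobNorm_sq]
  calc ∑ i, ∑ j, M i j ^ 2 ≤ ∑ _i : Fin a, ∑ _j : Fin b, r ^ 2 :=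
        Finset.sum_le_sum fun i _ => Finset.sum_le_sum fun j _ => by
          rw [← sq_abs]; exact pow_le_pow_left₀ (abs_nonneg _) (hM i j) 2
    _ = r ^ 2 * (a * b) := by simp; ring
    _ ≤ r ^ 2 * (h * h) := by gcongr
    _ = (r * h) ^ 2 := by ring

lemma specNorm_eq_zero_of_isEmpty {a b : ℕ} (M : Matrix (Fin a) (Fin b) ℝ) (h : a * b = 0) :
    specNorm M = 0 := by
  refine le_antisymm ((specNorm_le_frobNorm M).trans ?_) (specNorm_nonneg M)
  rcases Nat.mul_eq_zero.1 h with h | h <;> subst h <;> simp [frobNorm]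

/-! ### Size, stability and homogeneity of networks -/

section Networks

variable {d : ℕ} {s : ℕ → ℕ}

/-- The values that layer `k` passes on: the input at `k = 0`, the activated values otherwise. -/
def postact (W : Weights d s) (x : EuclideanSpace ℝ (Fin (s 0))) :
    (k : ℕ) → k ≤ d → Fin (s k) → ℝ
  | 0, _ => fun i => x i
  | k + 1, hk => fun i => relu (preact W x (k + 1) hk i)

/-- No ReLU acts on the input, so `preact` treats the first layer separately; `postact` absorbs this
case and makes the recursion uniform for the inductions below. -/
lemma preact_succ (W : Weights d s) (x : EuclideanSpace ℝ (Fin (s 0))) (k : ℕ) (hk : k + 1 ≤ d) :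
    preact W x (k + 1) hk = W ⟨k, hk⟩ *ᵥ postact W x k (Nat.le_of_succ_le hk) := by
  cases k <;> rfl

lemma relu_sq_le (t : ℝ) : relu t ^ 2 ≤ t ^ 2 := by
  rw [relu]
  rcases le_total t 0 with h | h
  · simp [h, sq_nonneg]
  · simp [h]

lemma relu_sub_sq_le (t r : ℝ) : (relu t - relu r) ^ 2 ≤ (t - r) ^ 2 :=
  sq_le_sq.2 (abs_max_sub_max_le_abs t r 0)

lemma relu_mul {c : ℝ} (hc : 0 ≤ c) (t : ℝ) : relu (c * t) = c * relu t := by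
  rw [relu, relu, mul_max_of_nonneg _ _ hc, mul_zero]

lemma euclNorm_postact_le (W : Weights d s) (x : EuclideanSpace ℝ (Fin (s 0))) (k : ℕ)
    (hk : k ≤ d) : euclNorm (postact W x k hk) ≤ euclNorm (preact W x k hk) := by
  cases k
  · rfl
  · exact euclNorm_le_of_sq_le fun i => relu_sq_le _

lemma euclNorm_postact_sub_le (W V : Weights d s) (x : EuclideanSpace ℝ (Fin (s 0))) (k : ℕ)
    (hk : k ≤ d) : euclNorm (postact V x k hk - postact W x k hk)
      ≤ euclNorm (preact V x k hk - preact W x k hk) := by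
  cases k
  · rfl
  · exact euclNorm_le_of_sq_le fun i => relu_sub_sq_le _ _

lemma postact_eq_smul {W V : Weights d s} {x : EuclideanSpace ℝ (Fin (s 0))} {k : ℕ}
    {hk : k ≤ d} {c : ℝ} (hc : 0 ≤ c) (h : preact W x k hk = c • preact V x k hk) :
    postact W x k hk = c • postact V x k hk := by
  cases k
  · exact h
  · ext i
    simp [postact, h, relu_mul hc]

lemma euclNorm_preact_le (W : Weights d s) (x : EuclideanSpace ℝ (Fin (s 0))) (b : ℕ → ℝ)
    (hb : ∀ i (hi : i < d), specNorm (W ⟨i, hi⟩) ≤ b i) (k : ℕ) (hk : k ≤ d) :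
    euclNorm (preact W x k hk) ≤ (∏ i ∈ Finset.range k, b i) * ‖x‖ := by
  induction k with
  | zero => simp [preact, euclNorm]
  | succ k ih =>
    rw [preact_succ, Finset.prod_range_succ_comm, mul_assoc]
    exact (euclNorm_mulVec_le _ _).trans (mul_le_mul (hb k hk)
      ((euclNorm_postact_le W x k _).trans (ih _)) (euclNorm_nonneg _)
      ((specNorm_nonneg _).trans (hb k hk)))

/-- Stability of a network under a perturbation of its weights. -/
lemma euclNorm_preact_sub_le (W V : Weights d s) (x : EuclideanSpace ℝ (Fin (s 0))) (b r : ℕ → ℝ)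
    (hb : ∀ i (hi : i < d), specNorm (W ⟨i, hi⟩) ≤ b i)
    (hr : ∀ i (hi : i < d), specNorm (V ⟨i, hi⟩ - W ⟨i, hi⟩) ≤ r i) (k : ℕ) (hk : k ≤ d) :
    euclNorm (preact V x k hk - preact W x k hk)
      ≤ (∏ i ∈ Finset.range k, (b i + r i) - ∏ i ∈ Finset.range k, b i) * ‖x‖ := by
  induction k with
  | zero => simp [preact, euclNorm]
  | succ k ih =>
    have hk' := Nat.le_of_succ_le hk
    have hV : specNorm (V ⟨k, hk⟩) ≤ b k + r k := by
      have := specNorm_add_le (W ⟨k, hk⟩) (V ⟨k, hk⟩ - W ⟨k, hk⟩)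
      rw [add_sub_cancel] at this
      exact this.trans (add_le_add (hb k hk) (hr k hk))
    -- The two terms are bounded by `(b k + r k) (∏ (b + r) - ∏ b) ‖x‖` and `r k (∏ b) ‖x‖`, whose
    -- sum telescopes to the claim for `k + 1`.
    have hsplit : preact V x (k + 1) hk - preact W x (k + 1) hk
        = V ⟨k, hk⟩ *ᵥ (postact V x k hk' - postact W x k hk')
          + (V ⟨k, hk⟩ - W ⟨k, hk⟩) *ᵥ postact W x k hk' := by
      rw [preact_succ, preact_succ, Matrix.mulVec_sub, Matrix.sub_mulVec]
      abel
    rw [hsplit, Finset.prod_range_succ, Finset.prod_range_succ]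
    refine (euclNorm_add_le _ _).trans ?_
    have h1 := (euclNorm_mulVec_le (V ⟨k, hk⟩) (postact V x k hk' - postact W x k hk')).trans
      (mul_le_mul hV ((euclNorm_postact_sub_le W V x k hk').trans (ih hk')) (euclNorm_nonneg _)
        ((specNorm_nonneg _).trans hV))
    have h2 := (euclNorm_mulVec_le (V ⟨k, hk⟩ - W ⟨k, hk⟩) (postact W x k hk')).trans
      (mul_le_mul (hr k hk) ((euclNorm_postact_le W x k hk').trans
        (euclNorm_preact_le W x b hb k hk')) (euclNorm_nonneg _)
        ((specNorm_nonneg _).trans (hr k hk)))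
    linarith

/-- Positive homogeneity of a network in the weights of each layer. -/
lemma preact_eq_smul (W V : Weights d s) (x : EuclideanSpace ℝ (Fin (s 0))) (c : ℕ → ℝ)
    (hc : ∀ i, 0 ≤ c i) (hW : ∀ i (hi : i < d), W ⟨i, hi⟩ = c i • V ⟨i, hi⟩) (k : ℕ)
    (hk : k ≤ d) :
    preact W x k hk = (∏ i ∈ Finset.range k, c i) • preact V x k hk := by
  induction k with
  | zero => simp [preact]
  | succ k ih =>
    rw [preact_succ, preact_succ, Finset.prod_range_succ_comm, hW k hk,
      postact_eq_smul (Finset.prod_nonneg fun i _ => hc i) (ih (Nat.le_of_succ_le hk)),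
      Matrix.smul_mulVec, Matrix.mulVec_smul, smul_smul]

lemma continuous_preact (W : Weights d s) (k : ℕ) (hk : k ≤ d) :
    Continuous fun x => preact W x k hk := by
  induction k with
  | zero => simp only [preact]; fun_prop
  | succ k ih =>
    simp only [preact_succ]
    refine Continuous.matrix_mulVec continuous_const ?_
    cases k with
    | zero => simp only [postact]; fun_prop
    | succ k =>
      have := ih (Nat.le_of_succ_le hk)
      simp only [postact, relu]
      fun_prop

lemma continuous_net (W : Weights d s) : Continuous (net W) := continuous_preact W d le_rfl

lemma euclNorm_net_le (W : Weights d s) (x : EuclideanSpace ℝ (Fin (s 0))) :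
    euclNorm (net W x) ≤ (∏ l, specNorm (W l)) * ‖x‖ := by
  -- The value 0 beyond the depth is arbitrary: the product only ranges over `i < d`.
  set b : ℕ → ℝ := fun i => if h : i < d then specNorm (W ⟨i, h⟩) else 0 with hb
  have hprod : ∏ l, specNorm (W l) = ∏ i ∈ Finset.range d, b i := by
    rw [← Fin.prod_univ_eq_prod_range]
    simp [hb]
  rw [hprod]
  exact euclNorm_preact_le W x b (fun i hi => by simp [hb, hi]) d le_rfl

/-- If all layers have spectral norm at most `b` and layer `l` is perturbed by at most `b * t l`,
then the outputs change by at most `b ^ d * (exp (∑ l, t l) - 1) * ‖x‖`. -/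
lemma euclNorm_net_sub_le (W V : Weights d s) (x : EuclideanSpace ℝ (Fin (s 0))) {b : ℝ}
    (hb0 : 0 ≤ b) (t : Fin d → ℝ) (hb : ∀ l, specNorm (W l) ≤ b) (ht0 : ∀ l, 0 ≤ t l)
    (ht : ∀ l, specNorm (V l - W l) ≤ b * t l) :
    euclNorm (net V x - net W x) ≤ b ^ d * (Real.exp (∑ l, t l) - 1) * ‖x‖ := by
  set r : ℕ → ℝ := fun i => if h : i < d then t ⟨i, h⟩ else 0 with hr
  have h := euclNorm_preact_sub_le W V x (fun _ => b) (fun i => b * r i) (fun i hi => hb _)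
    (fun i hi => by simpa [hr, hi] using ht ⟨i, hi⟩) d le_rfl
  refine h.trans (mul_le_mul_of_nonneg_right ?_ (norm_nonneg x))
  have h1 : ∏ i ∈ Finset.range d, (b + b * r i) = b ^ d * ∏ l, (1 + t l) := by
    rw [← Fin.prod_univ_eq_prod_range (fun i => b + b * r i)]
    simp [hr, ← mul_one_add, Finset.prod_mul_distrib]
  have h2 : ∏ l, (1 + t l) ≤ Real.exp (∑ l, t l) := by
    rw [Real.exp_sum]
    exact Finset.prod_le_prod (fun l _ => by linarith [ht0 l])
      fun l _ => by linarith [Real.add_one_le_exp (t l)]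
  rw [h1, Finset.prod_const, Finset.card_range, mul_sub, mul_one]
  gcongr

lemma net_smul (V : Weights d s) (x : EuclideanSpace ℝ (Fin (s 0))) (c : Fin d → ℝ)
    (hc : ∀ l, 0 ≤ c l) : net (fun l => c l • V l) x = (∏ l, c l) • net V x := by
  set c' : ℕ → ℝ := fun i => if h : i < d then c ⟨i, h⟩ else 0 with hc'
  have hprod : ∏ l, c l = ∏ i ∈ Finset.range d, c' i := by
    rw [← Fin.prod_univ_eq_prod_range]
    simp [hc']
  rw [hprod]
  refine preact_eq_smul _ V x c' (fun i => ?_) (fun i hi => by simp [hc', hi]) d le_rfl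
  by_cases h : i < d <;> simp [hc', h, hc]

lemma le_width {i : ℕ} (hi : i ≤ d) : s i ≤ width d s :=
  Finset.le_sup (f := s) (Finset.mem_range.2 (by omega))

/-- The number of weights is at most `d h²`. -/
lemma sum_layer_card_le : ∑ l : Fin d, (s (l + 1) * s l : ℝ) ≤ d * (width d s : ℝ) ^ 2 := by
  calc ∑ l : Fin d, (s (l + 1) * s l : ℝ)
      ≤ ∑ _l : Fin d, (width d s * width d s : ℝ) := by
        refine Finset.sum_le_sum fun l _ => ?_
        gcongr
        · exact le_width (by omega)
        · exact le_width (by omega)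
    _ = d * (width d s : ℝ) ^ 2 := by
        rw [Finset.sum_const, Finset.card_univ, Fintype.card_fin, nsmul_eq_mul, sq]

end Networks

/-! ### Divergence of product measures -/

/-- The chain rule with constant kernels splits off `klDiv μ ν` and leaves two products with common
first factor `μ`. Swapping turns this factor into a common kernel, which does not contribute. -/
lemma klDiv_prod {α β : Type*} [MeasurableSpace α] [MeasurableSpace β] (μ ν : Measure α)
    (μ' ν' : Measure β) [IsProbabilityMeasure μ] [IsProbabilityMeasure ν]
    [IsProbabilityMeasure μ'] [IsProbabilityMeasure ν'] :
    klDiv (μ.prod μ') (ν.prod ν') ≤ klDiv μ ν + klDiv μ' ν' := by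
  have h : klDiv (μ.prod μ') (μ.prod ν') ≤ klDiv μ' ν' := by
    rw [← Measure.prod_swap (μ := μ') (ν := μ), ← Measure.prod_swap (μ := ν') (ν := μ)]
    refine (klDiv_map_le _ _ measurable_swap).trans ?_
    rw [← Measure.compProd_const, ← Measure.compProd_const, klDiv_compProd_left]
  rw [← Measure.compProd_const, ← Measure.compProd_const, klDiv_compProd_eq_add,
    Measure.compProd_const, Measure.compProd_const]
  gcongr

lemma klDiv_pi_fin_le {n : ℕ} {X : Fin n → Type*} [∀ i, MeasurableSpace (X i)]
    (μ ν : (i : Fin n) → Measure (X i)) [∀ i, IsProbabilityMeasure (μ i)]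
    [∀ i, IsProbabilityMeasure (ν i)] :
    klDiv (Measure.pi μ) (Measure.pi ν) ≤ ∑ i, klDiv (μ i) (ν i) := by
  induction n with
  | zero =>
    rw [Measure.pi_of_empty μ, Measure.pi_of_empty ν, klDiv_self]
    simp
  | succ n ih =>
    rw [← (measurePreserving_piFinSuccAbove μ 0).symm.map_eq,
      ← (measurePreserving_piFinSuccAbove ν 0).symm.map_eq]
    refine (klDiv_map_le _ _ (MeasurableEquiv.measurable _)).trans ((klDiv_prod _ _ _ _).trans ?_)
    rw [Fin.sum_univ_succ]
    gcongr
    exact ih (fun j => μ (Fin.succAbove 0 j)) (fun j => ν (Fin.succAbove 0 j))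

/-- The divergence of product measures is at most the sum of the divergences of the factors. -/
lemma klDiv_pi_le {ι : Type*} [Fintype ι] {X : ι → Type*} [∀ i, MeasurableSpace (X i)]
    (μ ν : (i : ι) → Measure (X i)) [∀ i, IsProbabilityMeasure (μ i)]
    [∀ i, IsProbabilityMeasure (ν i)] :
    klDiv (Measure.pi μ) (Measure.pi ν) ≤ ∑ i, klDiv (μ i) (ν i) := by
  let e := (Fintype.equivFin ι).symm
  rw [← (measurePreserving_piCongrLeft μ e).map_eq, ← (measurePreserving_piCongrLeft ν e).map_eq]
  refine (klDiv_map_le _ _ (MeasurableEquiv.measurable _)).trans ((klDiv_pi_fin_le _ _).trans ?_)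
  exact (Equiv.sum_comp e fun i => klDiv (μ i) (ν i)).le

/-! ### Isotropic Gaussian measures -/

/-- The chain rule for densities with respect to Lebesgue measure expresses the likelihood ratio as
a quotient of Gaussian densities. -/
lemma llr_gaussianReal (m m' : ℝ) {v v' : ℝ≥0} (hv : v ≠ 0) (hv' : v' ≠ 0) :
    llr (gaussianReal m v) (gaussianReal m' v') =ᵐ[gaussianReal m v]
      fun x => Real.log (gaussianPDFReal m v x) - Real.log (gaussianPDFReal m' v' x) := by
  have hac : gaussianReal m v ≪ gaussianReal m' v' :=
    (gaussianReal_absolutelyContinuous m hv).trans (gaussianReal_absolutelyContinuous' m' hv')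
  refine (gaussianReal_absolutelyContinuous m hv).ae_le ?_
  filter_upwards [Measure.rnDeriv_mul_rnDeriv (κ := volume) hac, rnDeriv_gaussianReal m v,
    rnDeriv_gaussianReal m' v'] with x h h1 h2
  have hp := gaussianPDFReal_pos m v x hv
  have hq := gaussianPDFReal_pos m' v' x hv'
  rw [Pi.mul_apply, h1, h2] at h
  have h3 := congrArg ENNReal.toReal h
  rw [ENNReal.toReal_mul, toReal_gaussianPDF, toReal_gaussianPDF] at h3
  rw [llr, eq_div_of_mul_eq hq.ne' h3, Real.log_div hp.ne' hq.ne']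

lemma log_gaussianPDFReal (m : ℝ) {v : ℝ≥0} (hv : v ≠ 0) (x : ℝ) :
    Real.log (gaussianPDFReal m v x)
      = -(Real.log (2 * Real.pi) + Real.log v) / 2 - (x - m) ^ 2 / (2 * v) := by
  have hv' : (0 : ℝ) < v := by positivity
  rw [gaussianPDFReal, Real.log_mul (by positivity) (Real.exp_pos _).ne', Real.log_exp,
    Real.log_inv, Real.log_sqrt (by positivity), Real.log_mul (by positivity) hv'.ne']
  ring

lemma integrable_sub_sq_gaussianReal (m a : ℝ) (v : ℝ≥0) :
    Integrable (fun x => (x - a) ^ 2) (gaussianReal m v) :=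
  ((memLp_id_gaussianReal (μ := m) (v := v) 2).sub (memLp_const a)).integrable_sq

lemma integral_sub_sq_gaussianReal (m a : ℝ) (v : ℝ≥0) :
    ∫ x, (x - a) ^ 2 ∂gaussianReal m v = v + (m - a) ^ 2 := by
  have hid : Integrable (fun x => x) (gaussianReal m v) :=
    (memLp_id_gaussianReal (μ := m) (v := v) 1).integrable le_rfl
  have hvar : ∫ x, (x - m) ^ 2 ∂gaussianReal m v = v := by
    have := variance_fun_id_gaussianReal (μ := m) (v := v)
    rwa [variance_eq_integral (by fun_prop), integral_id_gaussianReal] at this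
  have : (fun x : ℝ => (x - a) ^ 2)
      = fun x => (x - m) ^ 2 + (2 * (m - a) * (x - m) + (m - a) ^ 2) := by
    ext x; ring
  rw [this]
  have hlin : Integrable (fun x => 2 * (m - a) * (x - m)) (gaussianReal m v) :=
    (hid.sub (integrable_const m)).const_mul _
  have hlin' : Integrable (fun x => 2 * (m - a) * (x - m) + (m - a) ^ 2) (gaussianReal m v) :=
    hlin.add (integrable_const _)
  rw [integral_add (integrable_sub_sq_gaussianReal m m v) hlin',
    integral_add hlin (integrable_const _), hvar, integral_const_mul,
    integral_sub hid (by fun_prop), integral_id_gaussianReal]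
  simp

/-- The exact value is `m² / (2v) + (r - 1 - log r) / 2`. The bounds `-log r ≤ r⁻¹ - 1` and `r ≤ 1`
leave `r⁻¹ - 1`, which is simply `η² a²` for the optimized covariance. -/
lemma klDiv_gaussianReal_le (m : ℝ) {r v : ℝ≥0} (hr : r ≠ 0) (hr1 : r ≤ 1) (hv : v ≠ 0) :
    klDiv (gaussianReal m (r * v)) (gaussianReal 0 v)
      ≤ ENNReal.ofReal (m ^ 2 / (2 * v) + ((r : ℝ)⁻¹ - 1) / 2) := by
  have hrv : r * v ≠ 0 := mul_ne_zero hr hv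
  have hr0 : (0 : ℝ) < r := by positivity
  have hv0 : (0 : ℝ) < v := by positivity
  have hr1' : (r : ℝ) ≤ 1 := hr1
  have hac : gaussianReal m (r * v) ≪ gaussianReal 0 v :=
    (gaussianReal_absolutelyContinuous m hrv).trans (gaussianReal_absolutelyContinuous' 0 hv)
  have hllr := llr_gaussianReal m 0 hrv hv
  have hform : (fun x => Real.log (gaussianPDFReal m (r * v) x)
        - Real.log (gaussianPDFReal 0 v x))
      = fun x => (x - 0) ^ 2 / (2 * v) - ((x - m) ^ 2 / (2 * (r * v)) + Real.log r / 2) := by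
    ext x
    rw [log_gaussianPDFReal m hrv, log_gaussianPDFReal 0 hv, NNReal.coe_mul,
      Real.log_mul hr0.ne' hv0.ne']
    ring
  rw [hform] at hllr
  have hi1 := (integrable_sub_sq_gaussianReal m 0 (r * v)).div_const (2 * v)
  have hi2 := (integrable_sub_sq_gaussianReal m m (r * v)).div_const (2 * (r * v))
  have hi3 : Integrable (fun x => (x - m) ^ 2 / (2 * (r * v : ℝ)) + Real.log r / 2)
      (gaussianReal m (r * v)) := hi2.add (integrable_const _)
  have hint := (hi1.sub hi3).congr hllr.symm
  rw [klDiv_of_ac_of_integrable hac hint, integral_congr_ae hllr, integral_sub hi1 hi3,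
    integral_add hi2 (integrable_const _), integral_div, integral_div,
    integral_sub_sq_gaussianReal, integral_sub_sq_gaussianReal]
  refine ENNReal.ofReal_le_ofReal ?_
  have hlog : -Real.log r ≤ (r : ℝ)⁻¹ - 1 := by
    rw [← Real.log_inv]; exact Real.log_le_sub_one_of_pos (by positivity)
  simp only [probReal_univ, integral_const, smul_eq_mul, one_mul, sub_zero, sub_self, NNReal.coe_mul]
  have h1 : ((r : ℝ) * v + m ^ 2) / (2 * v) = r / 2 + m ^ 2 / (2 * v) := by field_simp
  have h2 : ((r : ℝ) * v + 0 ^ 2) / (2 * (r * v)) = 1 / 2 := by field_simp; simp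
  rw [h1, h2]
  linarith

section Isotropic

variable {ι : Type*} [Fintype ι] [DecidableEq ι]

omit [Fintype ι] in
lemma posSemidef_smul_one (v : ℝ≥0) : ((v : ℝ) • (1 : Matrix ι ι ℝ)).PosSemidef :=
  Matrix.PosSemidef.one.smul v.2

/-- The coordinates of an isotropic Gaussian vector are independent. -/
lemma multivariateGaussian_smul_one (μ : EuclideanSpace ℝ ι) (v : ℝ≥0) :
    multivariateGaussian μ ((v : ℝ) • (1 : Matrix ι ι ℝ))
      = (Measure.pi fun i => gaussianReal (μ i) v).map (WithLp.toLp 2) := by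
  apply Measure.ext_of_charFun (E := EuclideanSpace ℝ ι)
  ext t
  rw [charFun_multivariateGaussian (posSemidef_smul_one v), charFun_pi]
  simp_rw [charFun_gaussianReal, ← Complex.exp_sum]
  congr 1
  simp only [PiLp.inner_apply, Matrix.smul_mulVec, dotProduct, Finset.sum_sub_distrib]
  simp only [RCLike.inner_apply, conj_trivial, Complex.ofReal_sum, Complex.ofReal_mul,
    Matrix.one_mulVec, Pi.smul_apply, smul_eq_mul, Finset.sum_mul, Finset.sum_div]
  congr 1
  · exact Finset.sum_congr rfl fun i _ => by ring
  · exact Finset.sum_congr rfl fun i _ => by ring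

lemma klDiv_multivariateGaussian_smul_one_le (μ : EuclideanSpace ℝ ι) {r v : ℝ≥0} (hr : r ≠ 0)
    (hr1 : r ≤ 1) (hv : v ≠ 0) :
    klDiv (multivariateGaussian μ (((r * v : ℝ≥0) : ℝ) • (1 : Matrix ι ι ℝ)))
        (multivariateGaussian 0 ((v : ℝ) • (1 : Matrix ι ι ℝ)))
      ≤ ENNReal.ofReal (∑ i, (μ i ^ 2 / (2 * v) + ((r : ℝ)⁻¹ - 1) / 2)) := by
  have hr1' : 0 ≤ (r : ℝ)⁻¹ - 1 := sub_nonneg.2 (by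
    rw [one_le_inv₀ (by positivity)]; exact hr1)
  rw [multivariateGaussian_smul_one, multivariateGaussian_smul_one]
  refine (klDiv_map_le _ _ (by fun_prop)).trans ((klDiv_pi_le _ _).trans ?_)
  rw [ENNReal.ofReal_sum_of_nonneg fun i _ => by positivity]
  exact Finset.sum_le_sum fun i _ => klDiv_gaussianReal_le (μ i) hr hr1 hv

lemma lintegral_apply_sq_multivariateGaussian (v : ℝ≥0) (i : ι) :
    ∫⁻ u, ENNReal.ofReal (u i ^ 2) ∂multivariateGaussian 0 ((v : ℝ) • (1 : Matrix ι ι ℝ)) = v := by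
  have h := measurePreserving_eval_multivariateGaussian (μ := 0) (posSemidef_smul_one (ι := ι) v)
    (i := i)
  have hv : (((v : ℝ) • (1 : Matrix ι ι ℝ)) i i).toNNReal = v := by simp
  rw [hv] at h
  rw [h.lintegral_comp (f := fun x => ENNReal.ofReal (x ^ 2)) (by fun_prop),
    ← ofReal_integral_eq_lintegral_ofReal]
  · have := integral_sub_sq_gaussianReal 0 0 v
    simp only [sub_zero] at this
    simp [this]
  · simpa using integrable_sub_sq_gaussianReal 0 0 v
  · exact Filter.Eventually.of_forall fun x => sq_nonneg x

end Isotropic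

/-! ### Perturbation and divergence bounds for layers of equal spectral norm -/

lemma two_le_kappa : 2 ≤ kappa := by
  have h1 := Real.log_two_gt_d9
  have h2 := Real.sqrt_nonneg (4 * Real.log 2)
  rw [kappa]
  linarith

lemma kappa_le : kappa ≤ 5 := by
  have h1 := Real.log_two_lt_d9
  have h2 : √(4 * Real.log 2) ≤ 2 := Real.sqrt_le_iff.2 ⟨by norm_num, by linarith⟩
  rw [kappa]
  linarith

lemma exp_one_sq_le : Real.exp 1 ^ 2 ≤ 7.4 := by
  have h := Real.exp_one_lt_d9
  have h0 := Real.exp_pos 1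
  nlinarith

lemma one_add_inv_pow_le (d : ℕ) {k : ℕ} (hk : k ≤ d) : (1 + 1 / (d : ℝ)) ^ k ≤ Real.exp 1 := by
  have hle : (1 : ℝ) ≤ 1 + 1 / d := by
    have : (0 : ℝ) ≤ 1 / d := by positivity
    linarith
  calc (1 + 1 / (d : ℝ)) ^ k ≤ (1 + 1 / (d : ℝ)) ^ d := pow_le_pow_right₀ hle hk
    _ ≤ Real.exp (1 / d) ^ d := by
        gcongr
        linarith [Real.add_one_le_exp (1 / (d : ℝ))]
    _ = Real.exp (d * (1 / d)) := by rw [← Real.exp_nat_mul]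
    _ ≤ Real.exp 1 := by
        refine Real.exp_le_exp.2 ?_
        rw [mul_one_div]
        exact div_self_le_one _

/-- An approximation `b'` of `b` up to a factor `1 ± 1 / d` approximates `b ^ (d - 1)` up to a
factor `e`. -/
lemma pow_le_exp_one_mul_pow {d : ℕ} (hd : 0 < d) {b b' : ℝ} (hb : 0 < b)
    (h : |b - b'| ≤ b / d) :
    b' ^ (d - 1) ≤ Real.exp 1 * b ^ (d - 1) ∧ b ^ (d - 1) ≤ Real.exp 1 * b' ^ (d - 1) := by
  obtain ⟨k, rfl⟩ : ∃ k, d = k + 1 := ⟨d - 1, by omega⟩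
  rw [Nat.add_sub_cancel]
  have he : 1 ≤ Real.exp 1 := Real.one_le_exp zero_le_one
  rcases Nat.eq_zero_or_pos k with rfl | hk
  · simp [he]
  have hk' : (0 : ℝ) < k := Nat.cast_pos.2 hk
  have habs := abs_le.1 h
  have hdiv : b / ((k + 1 : ℕ) : ℝ) = b * (1 / ((k + 1 : ℕ) : ℝ)) := by ring
  have h1 : b' ≤ (1 + 1 / ((k + 1 : ℕ) : ℝ)) * b := by linarith [habs.1]
  -- With `d = k + 1`, `b' ≥ b k / (k + 1)`, and `1 + 1 / k` is the inverse of this ratio; its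
  -- `k`-th power is still at most `e`. The case `k = 0` was set aside for this division.
  have h2 : b ≤ (1 + 1 / (k : ℝ)) * b' := by
    have h3 : b - b / ((k + 1 : ℕ) : ℝ) ≤ b' := by linarith [habs.2]
    calc b = (1 + 1 / (k : ℝ)) * (b - b / ((k + 1 : ℕ) : ℝ)) := by
          push_cast
          field_simp
          ring
      _ ≤ (1 + 1 / (k : ℝ)) * b' := by gcongr
  have hb' : 0 < b' := pos_of_mul_pos_right (hb.trans_le h2) (by positivity)
  constructor
  · calc b' ^ k ≤ ((1 + 1 / ((k + 1 : ℕ) : ℝ)) * b) ^ k := by gcongr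
      _ = (1 + 1 / ((k + 1 : ℕ) : ℝ)) ^ k * b ^ k := mul_pow _ _ _
      _ ≤ _ := by gcongr; exact one_add_inv_pow_le (k + 1) (Nat.le_succ k)
  · calc b ^ k ≤ ((1 + 1 / (k : ℝ)) * b') ^ k := by gcongr
      _ = (1 + 1 / (k : ℝ)) ^ k * b' ^ k := mul_pow _ _ _
      _ ≤ _ := by gcongr; exact one_add_inv_pow_le k le_rfl

lemma exp_sub_one_le {t : ℝ} (ht0 : 0 ≤ t) (ht1 : t ≤ 1) :
    Real.exp t - 1 ≤ Real.exp 1 * t := by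
  have h1 : Real.exp t * (1 - t) ≤ 1 := by
    calc Real.exp t * (1 - t) ≤ Real.exp t * Real.exp (-t) := by
          gcongr
          linarith [Real.add_one_le_exp (-t)]
      _ = 1 := by rw [← Real.exp_add]; simp
  have h2 : Real.exp t * t ≤ Real.exp 1 * t := by gcongr
  linarith

/-! ### Weight vectors under isotropic block Gaussians -/

section

variable {d : ℕ} {s : ℕ → ℕ}

/-- The squared Euclidean norm of a vector of weights. -/
def vecNormSq (u : WeightVec d s) : ℝ := ∑ l, ∑ p, u l p ^ 2

lemma blockNormSq_smul_one (a : ℝ) (u : WeightVec d s) :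
    blockNormSq (fun _ => a • 1) u = a ^ 2 * vecNormSq u := by
  simp [blockNormSq, vecNormSq, Matrix.smul_mulVec, mul_pow, Finset.mul_sum]

lemma vecNormSq_vec (W : Weights d s) : vecNormSq (vec W) = weightNormSq W := by
  simp [vecNormSq, weightNormSq, vec, frobNorm_sq, Fintype.sum_prod_type]

lemma sum_frobNorm_unvec_sq (u : WeightVec d s) :
    ∑ l, frobNorm (unvec u l) ^ 2 = vecNormSq u := by
  simp [vecNormSq, unvec, frobNorm_sq, Fintype.sum_prod_type]

lemma measurable_vecNormSq : Measurable (vecNormSq : WeightVec d s → ℝ) := by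
  unfold vecNormSq
  fun_prop

/-- The number of weights. -/
def numWeights (d : ℕ) (s : ℕ → ℕ) : ℝ := ∑ l : Fin d, (s (l + 1) * s l : ℝ)

lemma lintegral_vecNormSq (v : ℝ≥0) :
    ∫⁻ u : WeightVec d s, ENNReal.ofReal (vecNormSq u) ∂blockGaussian 0 (fun _ => (v : ℝ) • 1)
      = ENNReal.ofReal (numWeights d s * v) := by
  have hsum : ∀ u : WeightVec d s, ENNReal.ofReal (vecNormSq u)
      = ∑ l, ∑ p, ENNReal.ofReal (u l p ^ 2) := fun u => by
    rw [vecNormSq, ENNReal.ofReal_sum_of_nonneg fun l _ => by positivity]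
    exact Finset.sum_congr rfl fun l _ => ENNReal.ofReal_sum_of_nonneg fun p _ => by positivity
  have hterm : ∀ (l : Fin d) (p : LayerIndex s l),
      ∫⁻ u : WeightVec d s, ENNReal.ofReal (u l p ^ 2) ∂blockGaussian 0 (fun _ => (v : ℝ) • 1)
        = v := fun l p => by
    have h := measurePreserving_eval
      (fun l : Fin d => multivariateGaussian (0 : EuclideanSpace ℝ (LayerIndex s l))
        ((v : ℝ) • 1)) l
    rw [← lintegral_apply_sq_multivariateGaussian v p]
    exact h.lintegral_comp (f := fun x : EuclideanSpace ℝ (LayerIndex s l) =>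
      ENNReal.ofReal (x p ^ 2)) (by fun_prop)
  have hlayer : ∀ l : Fin d, ∫⁻ u : WeightVec d s, ∑ p, ENNReal.ofReal (u l p ^ 2)
      ∂blockGaussian 0 (fun _ => (v : ℝ) • 1) = ∑ _p : LayerIndex s l, (v : ℝ≥0∞) := fun l => by
    rw [lintegral_finsetSum _ fun p _ => by fun_prop]
    exact Finset.sum_congr rfl fun p _ => hterm l p
  simp_rw [hsum]
  rw [lintegral_finsetSum _ fun l _ => by fun_prop]
  simp_rw [hlayer]
  have hN : 0 ≤ numWeights d s := by unfold numWeights; positivity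
  rw [ENNReal.ofReal_mul hN, ENNReal.ofReal_coe_nnreal, numWeights,
    ENNReal.ofReal_sum_of_nonneg fun l _ => by positivity, Finset.sum_mul]
  refine Finset.sum_congr rfl fun l _ => ?_
  rw [ENNReal.ofReal_mul (by positivity)]
  simp

lemma klDiv_blockGaussian_le (w : WeightVec d s) {r v : ℝ≥0} (hr : r ≠ 0) (hr1 : r ≤ 1)
    (hv : v ≠ 0) :
    klDiv (blockGaussian w fun _ => ((r * v : ℝ≥0) : ℝ) • 1) (blockGaussian 0 fun _ => (v : ℝ) • 1)
      ≤ ENNReal.ofReal (vecNormSq w / (2 * v) + numWeights d s * (((r : ℝ)⁻¹ - 1) / 2)) := by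
  have hr1' : 0 ≤ (r : ℝ)⁻¹ - 1 := sub_nonneg.2 (by
    rw [one_le_inv₀ (by positivity)]; exact hr1)
  refine (klDiv_pi_le _ _).trans ((Finset.sum_le_sum fun l _ =>
    klDiv_multivariateGaussian_smul_one_le (w l) hr hr1 hv).trans_eq ?_)
  rw [← ENNReal.ofReal_sum_of_nonneg fun l _ => Finset.sum_nonneg fun p _ => by positivity]
  congr 1
  simp [vecNormSq, numWeights, Finset.sum_add_distrib, Finset.sum_div, Finset.sum_mul]

/-- The perturbation condition: a perturbation `u` that is small compared to the common spectral
norm `b` of the layers changes the outputs by at most `e √d B b^(d-1) ‖u‖`. -/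
lemma abs_net_add_unvec_sub_sq_le {W : Weights d s} {b B : ℝ} (hb : 0 < b)
    (hW : ∀ l, specNorm (W l) = b) {u : WeightVec d s} (hu : d * vecNormSq u ≤ b ^ 2)
    {x : EuclideanSpace ℝ (Fin (s 0))} (hx : ‖x‖ ≤ B) (j : Fin (s d)) :
    |net (W + unvec u) x j - net W x j| ^ 2
      ≤ (Real.exp 1 * √d * B * b ^ d / b) ^ 2 * vecNormSq u := by
  set T : ℝ := ∑ l, frobNorm (unvec u l) / b with hT
  have hT0 : 0 ≤ T := Finset.sum_nonneg fun l _ => div_nonneg (frobNorm_nonneg _) hb.le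
  -- Cauchy-Schwarz over the `d` layers: the source of the factor `√d` in the sensitivity.
  have hTsq : T ^ 2 * b ^ 2 ≤ d * vecNormSq u := by
    rw [hT, ← Finset.sum_div, div_pow, div_mul_cancel₀ _ (by positivity), ← sum_frobNorm_unvec_sq]
    simpa using sq_sum_le_card_mul_sum_sq (s := Finset.univ) (f := fun l => frobNorm (unvec u l))
  have hT1 : T ≤ 1 := by
    refine le_of_sq_le_sq ?_ zero_le_one
    have : T ^ 2 * b ^ 2 ≤ 1 ^ 2 * b ^ 2 := by linarith
    exact le_of_mul_le_mul_right this (by positivity)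
  have h := euclNorm_net_sub_le W (W + unvec u) x hb.le (fun l => frobNorm (unvec u l) / b)
    (fun l => (hW l).le) (fun l => div_nonneg (frobNorm_nonneg _) hb.le) fun l => by
      rw [mul_div_cancel₀ _ hb.ne', Pi.add_apply, add_sub_cancel_left]
      exact specNorm_le_frobNorm _
  have h2 : |net (W + unvec u) x j - net W x j| ≤ b ^ d * (Real.exp 1 * T) * B :=
    (abs_apply_le_euclNorm (net (W + unvec u) x - net W x) j).trans (h.trans (by
      have := exp_sub_one_le hT0 hT1
      have h0 : 0 ≤ Real.exp T - 1 := sub_nonneg.2 (Real.one_le_exp hT0)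
      gcongr))
  calc |net (W + unvec u) x j - net W x j| ^ 2 ≤ (b ^ d * (Real.exp 1 * T) * B) ^ 2 := by gcongr
    _ = (Real.exp 1 * B * b ^ d / b) ^ 2 * (T ^ 2 * b ^ 2) := by field_simp
    _ ≤ (Real.exp 1 * B * b ^ d / b) ^ 2 * (d * vecNormSq u) := by gcongr
    _ = _ := by
      have : √(d : ℝ) ^ 2 = d := Real.sq_sqrt (Nat.cast_nonneg d)
      simp only [mul_pow, div_pow, this]
      ring

lemma numWeights_le : numWeights d s ≤ d * (width d s : ℝ) ^ 2 := sum_layer_card_le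

end

/-! ### Part (a): layers of equal spectral norm -/

section EqualNorms

variable {d : ℕ} {s : ℕ → ℕ} {B γ β βhat : ℝ} {W : Weights d s}

lemma sensitivity_eq (hW : ∀ l, specNorm (W l) = β) :
    sensitivity B W = fun _ => (Real.exp 1 * √d * B * β ^ d / β) • 1 := by
  ext1 l
  simp [sensitivity, hW]

lemma optCov_eq (hW : ∀ l, specNorm (W l) = β) :
    optCov B γ W
      = fun _ => (1 + etaSq γ W * (Real.exp 1 * √d * B * β ^ d / β) ^ 2)⁻¹ • 1 := by
  ext1 l
  have hη : 0 ≤ etaSq γ W := by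
    have := two_le_kappa
    have : 0 ≤ weightNormSq W := Finset.sum_nonneg fun l _ => sq_nonneg _
    unfold etaSq
    positivity
  set a := Real.exp 1 * √d * B * β ^ d / β with ha
  have hne : 1 + etaSq γ W * a ^ 2 ≠ 0 := by positivity
  rw [optCov, sensitivity_eq hW, ← ha]
  refine Matrix.inv_eq_right_inv ?_
  have : (1 : Matrix (LayerIndex s l) (LayerIndex s l) ℝ)
      + etaSq γ W • ((a • (1 : Matrix (LayerIndex s l) (LayerIndex s l) ℝ))ᵀ * a • 1)
      = (1 + etaSq γ W * a ^ 2) • 1 := by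
    rw [Matrix.transpose_smul, Matrix.transpose_one, smul_mul_smul_comm, mul_one, smul_smul,
      add_smul, one_smul, sq]
  rw [this, smul_mul_smul_comm, mul_one, mul_inv_cancel₀ hne, one_smul]

/-- The matrices are scalar, so the traces count the weights. -/
lemma priorVar_eq : priorVar d s B γ βhat
    = (16 * Real.exp 1 ^ 2 * kappa / γ ^ 2 *
        ((Real.exp 1 * √d * B * βhat ^ (d - 1)) ^ 2 * numWeights d s))⁻¹ := by
  have h : ∑ l : Fin d, (sensitivityOfNorm (s := s) B βhat l *
      (sensitivityOfNorm (s := s) B βhat l)ᵀ).trace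
      = (Real.exp 1 * √d * B * βhat ^ (d - 1)) ^ 2 * numWeights d s := by
    rw [numWeights, Finset.mul_sum]
    refine Finset.sum_congr rfl fun l _ => ?_
    rw [sensitivityOfNorm, Matrix.transpose_smul, Matrix.transpose_one, smul_mul_smul_comm,
      mul_one, Matrix.trace_smul, Matrix.trace_one]
    simp [sq]
  rw [priorVar, h]

/-- The Gaussian posterior for layers of equal spectral norm. -/
theorem perturbationLaw_and_klDiv_le (hd : 0 < d) (hγ : 0 < γ)
    (hW : ∀ l, specNorm (W l) = β) (hle : γ ≤ 2 * B * β ^ d) (hβ : |β - βhat| ≤ β / d) :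
    (1 / 2 : ℝ≥0∞) ≤ perturbationLaw B γ (priorVar d s B γ βhat) W
        {u | blockNormSq (sensitivity B W) u < γ ^ 2 / 16 ∧
          ∀ x : EuclideanSpace ℝ (Fin (s 0)), ‖x‖ ≤ B → ∀ j : Fin (s d),
            |net (W + unvec u) x j - net W x j| ^ 2 ≤ blockNormSq (sensitivity B W) u} ∧
      klDiv (posterior B γ (priorVar d s B γ βhat) W) (prior d s (priorVar d s B γ βhat))
        ≤ ENNReal.ofReal
            (20000 * (B ^ 2 * d ^ 2 * width d s ^ 2 * spectralComplexity W / γ ^ 2)) := by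
  have hpos : 0 < B * β ^ d := by nlinarith
  have hβ0 : 0 < β := by
    have h0 : 0 ≤ β := hW ⟨0, hd⟩ ▸ specNorm_nonneg _
    refine h0.lt_of_ne fun h => ?_
    rw [← h, zero_pow hd.ne', mul_zero] at hpos
    exact hpos.false
  have hB0 : 0 < B := pos_of_mul_pos_left hpos (by positivity)
  have hd0 : (0 : ℝ) < d := Nat.cast_pos.2 hd
  have he := Real.exp_pos 1
  have hκ := two_le_kappa
  -- Without weights `priorVar` would be the default inverse of 0; a positive spectral norm excludes
  -- an empty first layer.
  have hN0 : 0 < numWeights d s := by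
    have hl : 0 < s ((⟨0, hd⟩ : Fin d) + 1) * s (⟨0, hd⟩ : Fin d) := by
      refine Nat.pos_of_ne_zero fun h => hβ0.ne ?_
      rw [← hW ⟨0, hd⟩, specNorm_eq_zero_of_isEmpty _ h]
    refine Finset.sum_pos' (fun l _ => by positivity) ⟨⟨0, hd⟩, Finset.mem_univ _, ?_⟩
    exact_mod_cast hl
  obtain ⟨hp1, hp2⟩ := pow_le_exp_one_mul_pow hd hβ0 hβ
  set p := β ^ (d - 1) with hp
  have hp0 : 0 < p := by positivity
  set q := βhat ^ (d - 1) with hq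
  -- Positivity is obtained for the power, not for `βhat`, which may be nonpositive when `d = 1`.
  have hq0 : 0 < q := pos_of_mul_pos_right (hp0.trans_le hp2) he.le
  have hdiv : β ^ d / β = p := by
    rw [hp, div_eq_iff hβ0.ne', ← pow_succ, Nat.sub_add_cancel hd]
  set a := Real.exp 1 * √d * B * β ^ d / β with ha
  have ha' : a = Real.exp 1 * √d * B * p := by rw [ha, mul_div_assoc, hdiv]
  have ha0 : 0 < a := by rw [ha']; positivity
  have hasq : a ^ 2 = Real.exp 1 ^ 2 * d * B ^ 2 * p ^ 2 := by
    rw [ha', mul_pow, mul_pow, mul_pow, Real.sq_sqrt hd0.le]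
  set w := weightNormSq W with hw
  have hw0 : 0 ≤ w := Finset.sum_nonneg fun l _ => sq_nonneg _
  have hη : etaSq γ W = 16 * kappa * w / γ ^ 2 := rfl
  have hη0 : 0 ≤ etaSq γ W := by rw [hη]; positivity
  have hvar := priorVar_eq (d := d) (s := s) (B := B) (γ := γ) (βhat := βhat)
  rw [mul_pow, mul_pow, mul_pow, Real.sq_sqrt hd0.le, ← hq] at hvar
  have hv0 : 0 < priorVar d s B γ βhat := by rw [hvar]; positivity
  set v : ℝ≥0 := ⟨priorVar d s B γ βhat, hv0.le⟩ with hv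
  have hvc : (v : ℝ) = priorVar d s B γ βhat := rfl
  have hv_ne : v ≠ 0 := fun h => hv0.ne' (by rw [← hvc, h]; rfl)
  have hr0 : 0 < (1 + etaSq γ W * a ^ 2)⁻¹ := by positivity
  set r : ℝ≥0 := ⟨(1 + etaSq γ W * a ^ 2)⁻¹, hr0.le⟩ with hr
  have hrc : (r : ℝ) = (1 + etaSq γ W * a ^ 2)⁻¹ := rfl
  have hr_ne : r ≠ 0 := fun h => hr0.ne' (by rw [← hrc, h]; rfl)
  have hr1 : r ≤ 1 := by
    rw [← NNReal.coe_le_coe, hrc, NNReal.coe_one]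
    exact inv_le_one_of_one_le₀ (by nlinarith [mul_nonneg hη0 (sq_nonneg a)])
  have hcov : (fun l => priorVar d s B γ βhat • optCov B γ W l)
      = fun _ => ((r * v : ℝ≥0) : ℝ) • 1 := by
    rw [optCov_eq hW]
    ext1 l
    rw [smul_smul, NNReal.coe_mul, hvc, hrc, mul_comm]
  constructor
  · rw [perturbationLaw, hcov, sensitivity_eq hW, ← ha]
    set P : Measure (WeightVec d s) := blockGaussian 0 fun _ => ((r * v : ℝ≥0) : ℝ) • 1 with hP
    have : IsProbabilityMeasure P := by rw [hP, blockGaussian]; infer_instance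
    have hmeas : Measurable fun u : WeightVec d s => ENNReal.ofReal (vecNormSq u) :=
      measurable_vecNormSq.ennreal_ofReal
    have hmarkov := meas_ge_le_lintegral_div (μ := P) hmeas.aemeasurable
      (ε := ENNReal.ofReal (γ ^ 2 / (16 * a ^ 2))) (by positivity) ENNReal.ofReal_ne_top
    rw [hP, lintegral_vecNormSq, ← hP, ← ENNReal.ofReal_div_of_pos (by positivity)] at hmarkov
    -- `numWeights d s * (r * v)` is the mean of `‖u‖²`. Dropping `r ≤ 1`, the ratio is `p² / (κ e²
    -- q²)`, at most 1/2 because `p ≤ e q` and `κ ≥ 2`.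
    have hbound : numWeights d s * ((r * v : ℝ≥0) : ℝ) / (γ ^ 2 / (16 * a ^ 2)) ≤ 1 / 2 := by
      have hv_le : numWeights d s * (v : ℝ) / (γ ^ 2 / (16 * a ^ 2)) ≤ 1 / 2 := by
        rw [hvc, hvar, hasq]
        have hpq : p ^ 2 ≤ Real.exp 1 ^ 2 * q ^ 2 := by rw [← mul_pow]; gcongr
        calc numWeights d s * (16 * Real.exp 1 ^ 2 * kappa / γ ^ 2 *
                (Real.exp 1 ^ 2 * d * B ^ 2 * q ^ 2 * numWeights d s))⁻¹
              / (γ ^ 2 / (16 * (Real.exp 1 ^ 2 * d * B ^ 2 * p ^ 2)))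
            = p ^ 2 / (kappa * (Real.exp 1 ^ 2 * q ^ 2)) := by field_simp
          _ ≤ (Real.exp 1 ^ 2 * q ^ 2) / (2 * (Real.exp 1 ^ 2 * q ^ 2)) := by gcongr
          _ = 1 / 2 := by field_simp
      have hr1' : (r : ℝ) ≤ 1 := hr1
      refine le_trans ?_ hv_le
      rw [NNReal.coe_mul]
      gcongr
      exact mul_le_of_le_one_left v.2 hr1'
    have hhalf : P {u | ENNReal.ofReal (γ ^ 2 / (16 * a ^ 2)) ≤ ENNReal.ofReal (vecNormSq u)}
        ≤ 1 / 2 := by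
      refine hmarkov.trans ((ENNReal.ofReal_le_ofReal hbound).trans_eq ?_)
      rw [ENNReal.ofReal_div_of_pos two_pos]
      simp
    have hcompl := prob_compl_eq_one_sub (μ := P) (measurableSet_le
      (measurable_const (a := ENNReal.ofReal (γ ^ 2 / (16 * a ^ 2)))) hmeas)
    have hge : (1 / 2 : ℝ≥0∞) ≤ P {u | ENNReal.ofReal (γ ^ 2 / (16 * a ^ 2))
        ≤ ENNReal.ofReal (vecNormSq u)}ᶜ := by
      rw [hcompl]
      refine le_trans (le_of_eq ?_) (tsub_le_tsub_left hhalf 1)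
      simp
    refine hge.trans (measure_mono fun u hu => ?_)
    have hu' : vecNormSq u < γ ^ 2 / (16 * a ^ 2) := by
      rw [Set.mem_compl_iff, Set.mem_ofPred_eq, not_le] at hu
      exact (ENNReal.ofReal_lt_ofReal_iff (by positivity)).1 hu
    have hu2 : a ^ 2 * vecNormSq u < γ ^ 2 / 16 := by
      calc a ^ 2 * vecNormSq u < a ^ 2 * (γ ^ 2 / (16 * a ^ 2)) := by gcongr
        _ = γ ^ 2 / 16 := by field_simp
    simp only [Set.mem_ofPred_eq, blockNormSq_smul_one]
    refine ⟨hu2, fun x hx j => abs_net_add_unvec_sub_sq_le hβ0 hW ?_ hx j⟩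
    have he1 : 1 ≤ Real.exp 1 ^ 2 := one_le_pow₀ (Real.one_le_exp zero_le_one)
    have hu0 : 0 ≤ vecNormSq u :=
      Finset.sum_nonneg fun l _ => Finset.sum_nonneg fun p _ => sq_nonneg _
    have hβd : β ^ d = p * β := by rw [← hdiv, div_mul_cancel₀ _ hβ0.ne']
    -- The hypothesis `γ ≤ 2 B β^d` turns smallness relative to the margin into smallness relative
    -- to `β`.
    have h3 : (B * p) ^ 2 * (d * vecNormSq u) ≤ (B * p) ^ 2 * β ^ 2 := by
      calc (B * p) ^ 2 * (d * vecNormSq u)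
          ≤ Real.exp 1 ^ 2 * ((B * p) ^ 2 * (d * vecNormSq u)) :=
            le_mul_of_one_le_left (by positivity) he1
        _ = a ^ 2 * vecNormSq u := by rw [hasq]; ring
        _ ≤ γ ^ 2 / 16 := hu2.le
        _ ≤ (2 * B * β ^ d) ^ 2 / 16 := by gcongr
        _ = (B * p) ^ 2 * β ^ 2 / 4 := by rw [hβd]; ring
        _ ≤ (B * p) ^ 2 * β ^ 2 := by
          have : 0 ≤ (B * p) ^ 2 * β ^ 2 := by positivity
          linarith
    exact le_of_mul_le_mul_left h3 (by positivity)
  · rw [posterior, hcov, prior, ← hvc]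
    refine (klDiv_blockGaussian_le (vec W) hr_ne hr1 hv_ne).trans (ENNReal.ofReal_le_ofReal ?_)
    have hΦ : spectralComplexity W = p ^ 2 * w := by
      simp only [spectralComplexity, hW, ← Finset.sum_div]
      rw [hw, weightNormSq, ← hdiv]
      simp
      ring
    have hpq : q ^ 2 ≤ Real.exp 1 ^ 2 * p ^ 2 := by rw [← mul_pow]; gcongr
    have hκ5 := kappa_le
    have he2 := exp_one_sq_le
    have hvinv : ((v : ℝ))⁻¹ = 16 * Real.exp 1 ^ 2 * kappa / γ ^ 2 *
        (Real.exp 1 ^ 2 * d * B ^ 2 * q ^ 2 * numWeights d s) := by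
      rw [hvc, hvar, inv_inv]
    have h1 : vecNormSq (vec W) / (2 * v) = w / 2 * (v : ℝ)⁻¹ := by
      rw [vecNormSq_vec, ← hw]; field_simp
    rw [h1, hvinv, hrc, inv_inv, add_sub_cancel_left, hη, hasq, hΦ]
    -- The first term is the mean shift, the second the covariance change. The numerical bounds use
    -- `κ ≤ 5` and `e² ≤ 7.4`; the resulting constant is below 16505.
    calc w / 2 * (16 * Real.exp 1 ^ 2 * kappa / γ ^ 2 *
            (Real.exp 1 ^ 2 * d * B ^ 2 * q ^ 2 * numWeights d s))
          + numWeights d s * (16 * kappa * w / γ ^ 2 * (Real.exp 1 ^ 2 * d * B ^ 2 * p ^ 2) / 2)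
        = 8 * kappa * Real.exp 1 ^ 2 * (Real.exp 1 ^ 2 * q ^ 2 + p ^ 2)
            * (B ^ 2 * d * w * numWeights d s / γ ^ 2) := by field_simp; ring
      _ ≤ 8 * 5 * 7.4 * (7.4 * (7.4 * p ^ 2) + p ^ 2)
            * (B ^ 2 * d * w * (d * (width d s : ℝ) ^ 2) / γ ^ 2) := by
          have hq' : q ^ 2 ≤ 7.4 * p ^ 2 := hpq.trans (by gcongr)
          gcongr
          exact numWeights_le
      _ = 8 * 5 * 7.4 * (7.4 * 7.4 + 1)
            * (B ^ 2 * d ^ 2 * width d s ^ 2 * (p ^ 2 * w) / γ ^ 2) := by ring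
      _ ≤ _ := by
          gcongr
          norm_num

end EqualNorms

/-! ### A weighted union bound -/

section UnionBound

variable {Z : Type*} [MeasurableSpace Z] (D : Measure Z) [IsProbabilityMeasure D]

/-- Hoeffding's inequality for the average of a loss with values in `[0, 1]`. -/
lemma pi_average_le_sub_le {f : Z → ℝ} (hf : Measurable f) (h01 : ∀ z, f z ∈ Set.Icc (0 : ℝ) 1)
    {m : ℕ} (hm : 0 < m) {t : ℝ} (ht : 0 ≤ t) :
    Measure.pi (fun _ : Fin m => D) {S | (∑ k, f (S k)) / m + t < ∫ z, f z ∂D}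
      ≤ ENNReal.ofReal (Real.exp (-(2 * m * t ^ 2))) := by
  set P := Measure.pi (fun _ : Fin m => D)
  have hm0 : (0 : ℝ) < m := Nat.cast_pos.2 hm
  -- Averages far below the mean are an upper tail for `-f`, which takes values in `[-1, 0]`.
  have hg : Measurable fun z => -f z := hf.neg
  have hind : iIndepFun (fun (k : Fin m) (S : Fin m → Z) => -f (S k) - ∫ z, -f z ∂D) P :=
    iIndepFun_pi (X := fun _ z => -f z - ∫ z, -f z ∂D) fun _ => (hg.sub_const _).aemeasurable
  have hsub : ∀ k ∈ (Finset.univ : Finset (Fin m)),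
      HasSubgaussianMGF (fun S : Fin m → Z => -f (S k) - ∫ z, -f z ∂D)
        ((‖(0 : ℝ) - (-1)‖₊ / 2) ^ 2) P := fun k _ => by
    have h := hasSubgaussianMGF_of_mem_Icc (μ := D) (a := -1) (b := 0) hg.aemeasurable
      (Filter.Eventually.of_forall fun z => ⟨neg_le_neg (h01 z).2, neg_nonpos.2 (h01 z).1⟩)
    have hmp := measurePreserving_eval (fun _ : Fin m => D) k
    rw [← hmp.map_eq] at h
    have h' := HasSubgaussianMGF.of_map (Y := fun S : Fin m → Z => S k)
      hmp.measurable.aemeasurable h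
    rw [hmp.map_eq] at h'
    exact h'
  have hH := HasSubgaussianMGF.measure_sum_ge_le_of_iIndepFun hind hsub
    (mul_nonneg hm0.le ht)
  have hexp : -((m : ℝ) * t) ^ 2 / (2 * ((∑ _k : Fin m, (‖(0 : ℝ) - (-1)‖₊ / 2) ^ 2 : ℝ≥0) : ℝ))
      = -(2 * m * t ^ 2) := by
    simp
    field_simp
  rw [hexp] at hH
  refine le_trans (measure_mono fun S hS => ?_)
    ((ENNReal.le_ofReal_iff_toReal_le (measure_ne_top _ _) (Real.exp_pos _).le).2 hH)
  rw [Set.mem_ofPred_eq] at hS ⊢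
  rw [Finset.sum_sub_distrib, integral_neg]
  simp only [Finset.sum_neg_distrib, Finset.sum_const, Finset.card_univ, Fintype.card_fin,
    nsmul_eq_mul]
  have : (m : ℝ) * ((∑ k, f (S k)) / m + t) ≤ m * ∫ z, f z ∂D := by gcongr
  rw [mul_add, mul_div_cancel₀ _ hm0.ne'] at this
  linarith

/-- A union bound over a countable family of losses, weighted by a probability measure `P` on the
family. -/
theorem exists_forall_integral_le_average_add {ι : Type*} [Countable ι] [MeasurableSpace ι]
    [MeasurableSingletonClass ι] (P : Measure ι) [IsProbabilityMeasure P] (hP : ∀ i, P {i} ≠ 0)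
    {f : ι → Z → ℝ} (hf : ∀ i, Measurable (f i)) (h01 : ∀ i z, f i z ∈ Set.Icc (0 : ℝ) 1)
    {m : ℕ} (hm : 0 < m) {δ : ℝ} (hδ : 0 < δ) (hδ1 : δ ≤ 1) :
    ∃ E : Set (Fin m → Z), MeasurableSet E ∧
      ENNReal.ofReal (1 - δ) ≤ Measure.pi (fun _ : Fin m => D) E ∧
      ∀ S ∈ E, ∀ i, ∫ z, f i z ∂D ≤ (∑ k, f i (S k)) / m
        + √((Real.log (1 / δ) - Real.log (P.real {i})) / (2 * m)) := by
  set t : ι → ℝ := fun i => √((Real.log (1 / δ) - Real.log (P.real {i})) / (2 * m)) with ht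
  set bad : ι → Set (Fin m → Z) := fun i => {S | (∑ k, f i (S k)) / m + t i < ∫ z, f i z ∂D}
    with hbad
  have hm0 : (0 : ℝ) < m := Nat.cast_pos.2 hm
  have hbad_meas : ∀ i, MeasurableSet (bad i) := fun i => by
    refine measurableSet_lt ?_ measurable_const
    have := hf i
    fun_prop
  have hbad_le : ∀ i, Measure.pi (fun _ : Fin m => D) (bad i) ≤ ENNReal.ofReal δ * P {i} := by
    intro i
    refine (pi_average_le_sub_le D (hf i) (h01 i) hm (Real.sqrt_nonneg _)).trans_eq ?_
    have hpi : 0 < P.real {i} := ENNReal.toReal_pos (hP i) (measure_ne_top _ _)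
    have hpi1 : P.real {i} ≤ 1 := measureReal_le_one
    have hlog1 : Real.log (P.real {i}) ≤ 0 := Real.log_nonpos hpi.le hpi1
    have hlog2 : 0 ≤ Real.log (1 / δ) := Real.log_nonneg (by rw [le_div_iff₀ hδ]; linarith)
    have hnn : 0 ≤ (Real.log (1 / δ) - Real.log (P.real {i})) / (2 * m) :=
      div_nonneg (by linarith) (by positivity)
    -- The deviation `t i` is chosen so that Hoeffding's bound equals `δ * P {i}`; these sum to `δ`.
    have hexp : -(2 * (m : ℝ) * t i ^ 2) = Real.log (δ * P.real {i}) := by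
      rw [ht, Real.sq_sqrt hnn, mul_div_cancel₀ _ (by positivity), Real.log_mul hδ.ne' hpi.ne',
        one_div, Real.log_inv]
      ring
    rw [hexp, Real.exp_log (by positivity), ENNReal.ofReal_mul hδ.le, Measure.real,
      ENNReal.ofReal_toReal (measure_ne_top _ _)]
  refine ⟨(⋃ i, bad i)ᶜ, (MeasurableSet.iUnion hbad_meas).compl, ?_, fun S hS i => ?_⟩
  · have hsum : ∑' i, P {i} = 1 := by
      have := Measure.tsum_indicator_apply_singleton P Set.univ MeasurableSet.univ
      simpa using this
    have hU : Measure.pi (fun _ : Fin m => D) (⋃ i, bad i) ≤ ENNReal.ofReal δ := by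
      refine (measure_iUnion_le bad).trans ((ENNReal.tsum_le_tsum hbad_le).trans_eq ?_)
      rw [ENNReal.tsum_mul_left, hsum, mul_one]
    rw [prob_compl_eq_one_sub (MeasurableSet.iUnion hbad_meas), ENNReal.ofReal_sub _ hδ.le,
      ENNReal.ofReal_one]
    exact tsub_le_tsub_left hU 1
  · by_contra h
    exact hS (Set.mem_iUnion.2 ⟨i, not_le.1 h⟩)

end UnionBound

/-! ### A geometric prior on lattices -/

/-- The geometric distribution `2^(-(n+1))` on the natural numbers. -/
def geomPMF : PMF ℕ :=
  ⟨fun n => (2⁻¹ : ℝ≥0∞) ^ (n + 1), by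
    have h : ∑' n : ℕ, (2⁻¹ : ℝ≥0∞) ^ (n + 1) = 1 := by
      simp_rw [pow_succ]
      rw [ENNReal.tsum_mul_right, ENNReal.tsum_geometric, ENNReal.one_sub_inv_two, inv_inv]
      exact ENNReal.mul_inv_cancel (by norm_num) (by norm_num)
    exact h ▸ ENNReal.summable.hasSum⟩

/-- A two-sided geometric distribution on the integers. -/
def geomIntPMF : PMF ℤ := geomPMF.map Equiv.intEquivNat.symm

lemma geomPMF_apply (n : ℕ) : geomPMF n = 2⁻¹ ^ (n + 1) := rfl

lemma geomIntPMF_apply (k : ℤ) : geomIntPMF k = 2⁻¹ ^ (Equiv.intEquivNat k + 1) := by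
  rw [geomIntPMF, PMF.map_apply, tsum_eq_single (Equiv.intEquivNat k)]
  · simp [geomPMF_apply]
  · intro n hn
    rw [if_neg]
    rintro rfl
    simp at hn

/-- The code of `k` is `2k` or `2|k| - 1`, and `|k| ≤ k²` for integers. The quadratic form lets the
code lengths add up to a squared Frobenius norm. -/
lemma intEquivNat_le (k : ℤ) : (Equiv.intEquivNat k : ℤ) ≤ 2 * k ^ 2 := by
  have h : (Equiv.intEquivNat k : ℤ) ≤ 2 * |k| := by
    cases k with
    | ofNat n =>
      have : Equiv.intEquivNat (Int.ofNat n) = 2 * n := rfl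
      rw [this]
      simp
    | negSucc n =>
      have : Equiv.intEquivNat (Int.negSucc n) = 2 * n + 1 := rfl
      rw [this, Int.negSucc_eq, abs_neg, abs_of_nonneg (by positivity)]
      push_cast
      linarith
  have h2 : |k| ≤ k ^ 2 := by
    rw [← sq_abs, sq]
    rcases (abs_nonneg k).eq_or_lt with h0 | h0
    · rw [← h0]; simp
    · nlinarith
  linarith

section LatticePrior

variable {d : ℕ} {s : ℕ → ℕ}

/-- Resolutions and integer weights indexing the lattices of networks. -/
abbrev LatticeIndex (d : ℕ) (s : ℕ → ℕ) : Type := ℕ × ((l : Fin d) → LayerIndex s l → ℤ)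

/-- The geometric prior on the resolution and on each of the integer weights. -/
def latticePrior (d : ℕ) (s : ℕ → ℕ) : Measure (LatticeIndex d s) :=
  geomPMF.toMeasure.prod
    (Measure.pi fun l : Fin d => Measure.pi fun _ : LayerIndex s l => geomIntPMF.toMeasure)

instance : IsProbabilityMeasure (latticePrior d s) := by
  unfold latticePrior
  infer_instance

lemma latticePrior_singleton (i : LatticeIndex d s) :
    latticePrior d s {i}
      = 2⁻¹ ^ (i.1 + 1) * ∏ l, ∏ q, 2⁻¹ ^ (Equiv.intEquivNat (i.2 l q) + 1) := by
  obtain ⟨j, k⟩ := i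
  rw [latticePrior, ← Set.singleton_prod_singleton, Measure.prod_prod, Measure.pi_singleton,
    PMF.toMeasure_apply_singleton _ _ (MeasurableSet.singleton _), geomPMF_apply]
  congr 1
  refine Finset.prod_congr rfl fun l _ => ?_
  rw [Measure.pi_singleton]
  refine Finset.prod_congr rfl fun q _ => ?_
  rw [PMF.toMeasure_apply_singleton _ _ (MeasurableSet.singleton _), geomIntPMF_apply]

lemma latticePrior_singleton_ne_zero (i : LatticeIndex d s) : latticePrior d s {i} ≠ 0 := by
  rw [latticePrior_singleton]
  exact mul_ne_zero (by simp) (Finset.prod_ne_zero_iff.2 fun l _ =>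
    Finset.prod_ne_zero_iff.2 fun q _ => by simp)

lemma neg_log_latticePrior_le (i : LatticeIndex d s) :
    -Real.log ((latticePrior d s).real {i})
      ≤ (i.1 + 1) + (numWeights d s + 2 * ∑ l, ∑ q, (i.2 l q : ℝ) ^ 2) := by
  have hpow : ∀ n : ℕ, -Real.log ((2⁻¹ : ℝ) ^ n) ≤ n := fun n => by
    have := Real.log_two_lt_d9
    rw [Real.log_pow, Real.log_inv, mul_neg, neg_neg]
    exact mul_le_of_le_one_right (Nat.cast_nonneg n) (by linarith)
  rw [Measure.real, latticePrior_singleton, ENNReal.toReal_mul, ENNReal.toReal_prod]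
  simp only [ENNReal.toReal_prod, ENNReal.toReal_pow, ENNReal.toReal_inv, ENNReal.toReal_ofNat]
  rw [Real.log_mul (by positivity) (by positivity), Real.log_prod fun l _ => by positivity,
    neg_add]
  refine add_le_add (by exact_mod_cast hpow (i.1 + 1)) ?_
  have hN : numWeights d s + 2 * ∑ l, ∑ q, (i.2 l q : ℝ) ^ 2
      = ∑ l, ∑ q, (1 + 2 * (i.2 l q : ℝ) ^ 2) := by
    simp [numWeights, Finset.sum_add_distrib, Finset.mul_sum]
  rw [hN, ← Finset.sum_neg_distrib]
  refine Finset.sum_le_sum fun l _ => ?_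
  rw [Real.log_prod fun q _ => by positivity, ← Finset.sum_neg_distrib]
  refine Finset.sum_le_sum fun q _ => (hpow _).trans ?_
  have h : ((Equiv.intEquivNat (i.2 l q) : ℤ) : ℝ) ≤ ((2 * i.2 l q ^ 2 : ℤ) : ℝ) :=
    Int.cast_le.2 (intEquivNat_le _)
  push_cast at h ⊢
  linarith

end LatticePrior

/-! ### Margin losses under rescaling and perturbation -/

section MarginLoss

variable {K : ℕ}

lemma marginLoss_mem_Icc (γ : ℝ) (v : Fin K → ℝ) (y : Fin K) :
    marginLoss γ v y ∈ Set.Icc (0 : ℝ) 1 := by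
  unfold marginLoss
  split_ifs <;> simp

lemma nonempty_ne (hK : 2 ≤ K) (y : Fin K) : Nonempty {j : Fin K // j ≠ y} := by
  have : Nontrivial (Fin K) := Fin.nontrivial_iff_two_le.2 hK
  obtain ⟨j, hj⟩ := exists_ne y
  exact ⟨⟨j, hj⟩⟩

/-- The true score and the best competing score each move by at most `a`, so the margin moves by at
most `2a`. Two classes are needed for the supremum to range over a nonempty set. -/
lemma marginLoss_le_marginLoss (hK : 2 ≤ K) {γ γ' a : ℝ} {v v' : Fin K → ℝ}
    (h : ∀ j, |v' j - v j| ≤ a) (hγ : γ + 2 * a ≤ γ') (y : Fin K) :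
    marginLoss γ v y ≤ marginLoss γ' v' y := by
  have := nonempty_ne hK y
  by_cases hv : v y ≤ γ + ⨆ j : {j : Fin K // j ≠ y}, v j
  · have hsup : ⨆ j : {j : Fin K // j ≠ y}, v j ≤ a + ⨆ j : {j : Fin K // j ≠ y}, v' j := by
      refine ciSup_le fun j => ?_
      have h1 := le_ciSup (Set.finite_range fun j : {j : Fin K // j ≠ y} => v' j).bddAbove j
      have h2 := (abs_le.1 (h j)).1
      linarith
    have h3 := (abs_le.1 (h y)).2
    have hv' : v' y ≤ γ' + ⨆ j : {j : Fin K // j ≠ y}, v' j := by linarith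
    rw [marginLoss, marginLoss, if_pos hv, if_pos hv']
  · rw [marginLoss, if_neg hv]
    exact (marginLoss_mem_Icc γ' v' y).1

lemma marginLoss_smul {γ c : ℝ} (hc : 0 < c) (v : Fin K → ℝ) (y : Fin K) :
    marginLoss γ (c • v) y = marginLoss (γ / c) v y := by
  have hiff : c * v y ≤ γ + c * (⨆ j : {j : Fin K // j ≠ y}, v j)
      ↔ v y ≤ γ / c + ⨆ j : {j : Fin K // j ≠ y}, v j := by
    rw [← mul_le_mul_iff_right₀ (b := v y) hc, mul_add, mul_div_cancel₀ _ hc.ne']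
  simp only [marginLoss, Pi.smul_apply, smul_eq_mul, ← Real.mul_iSup_of_nonneg hc.le, hiff]

lemma marginLoss_eq_one (hK : 2 ≤ K) {γ : ℝ} {v : Fin K → ℝ} (h : ∀ j, |v j| ≤ γ / 2)
    (y : Fin K) : marginLoss γ v y = 1 := by
  obtain ⟨j⟩ := nonempty_ne hK y
  have h1 := le_ciSup (Set.finite_range fun j : {j : Fin K // j ≠ y} => v j).bddAbove j
  have h2 := (abs_le.1 (h j)).1
  have h3 := (abs_le.1 (h y)).2
  rw [marginLoss, if_pos (by linarith)]

end MarginLoss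

section

variable {d : ℕ} {s : ℕ → ℕ}

lemma measurable_marginLoss_net (γ : ℝ) (W : Weights d s) :
    Measurable fun p : EuclideanSpace ℝ (Fin (s 0)) × Fin (s d) =>
      marginLoss γ (net W p.1) p.2 := by
  refine measurable_from_prod_countable_left fun y => ?_
  have hnet : Measurable fun x => net W x := (continuous_net W).measurable
  have hj : ∀ j, Measurable fun x => net W x j := fun j => (measurable_pi_apply j).comp hnet
  refine Measurable.ite (measurableSet_le (hj y) ?_) measurable_const measurable_const
  exact measurable_const.add (Measurable.iSup fun j : {j : Fin (s d) // j ≠ y} => hj j)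

/-! ### Approximation by lattice networks -/

/-- The network with weights in a lattice of mesh `2^(-j) / (8 d h)`. -/
def latticeWeights (i : LatticeIndex d s) : Weights d s :=
  fun l => Matrix.of fun a b => (2⁻¹ : ℝ) ^ i.1 / (8 * d * width d s) * i.2 l (a, b)

/-- The loss of a lattice network at a margin of the order of its resolution. -/
def latticeLoss (B : ℝ) (i : LatticeIndex d s)
    (p : EuclideanSpace ℝ (Fin (s 0)) × Fin (s d)) : ℝ :=
  marginLoss (B * (2⁻¹ : ℝ) ^ i.1 / 2) (net (latticeWeights i) p.1) p.2

/-- A nonzero rounded value has modulus at least 1, so the rounding error 1/2 is at most half of it.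
Small weights thus round to 0, and no additive error accumulates. -/
lemma round_sq_le (t : ℝ) : (round t : ℝ) ^ 2 ≤ 4 * t ^ 2 := by
  have h := abs_sub_round t
  rcases eq_or_ne (round t) 0 with h0 | h0
  · rw [h0]; norm_num; positivity
  · have h1 : (1 : ℝ) ≤ |(round t : ℝ)| := by exact_mod_cast Int.one_le_abs h0
    have h2 : |(round t : ℝ)| ≤ |t| + 1 / 2 := by
      have := abs_sub_abs_le_abs_sub (round t : ℝ) t
      rw [abs_sub_comm] at this
      linarith
    have h3 : |(round t : ℝ)| ≤ 2 * |t| := by linarith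
    calc (round t : ℝ) ^ 2 = |(round t : ℝ)| ^ 2 := (sq_abs _).symm
      _ ≤ (2 * |t|) ^ 2 := by gcongr
      _ = 4 * t ^ 2 := by rw [mul_pow, sq_abs]; norm_num

/-- Every network whose margin loss at `γ` is not trivially one is approximated by a lattice
network whose description length is at most a multiple of the spectral complexity. -/
lemma exists_latticeIndex (hd : 0 < d) (hK : 2 ≤ s d) {B γ : ℝ} (hγ : 0 < γ)
    (W : Weights d s) (hY : γ < 2 * B * ∏ l, specNorm (W l)) :
    ∃ i : LatticeIndex d s,
      (∀ p : EuclideanSpace ℝ (Fin (s 0)) × Fin (s d), ‖p.1‖ ≤ B →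
        marginLoss 0 (net W p.1) p.2 ≤ latticeLoss B i p ∧
        latticeLoss B i p ≤ marginLoss γ (net W p.1) p.2) ∧
      (i.1 + 1) + (numWeights d s + 2 * ∑ l, ∑ q, (i.2 l q : ℝ) ^ 2)
        ≤ 2056 * (B ^ 2 * d ^ 2 * width d s ^ 2 * spectralComplexity W / γ ^ 2) := by
  set c := ∏ l, specNorm (W l) with hc
  have hc_nonneg : 0 ≤ c := Finset.prod_nonneg fun l _ => specNorm_nonneg _
  have hc0 : 0 < c := by
    refine hc_nonneg.lt_of_ne fun h => ?_
    rw [← h, mul_zero] at hY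
    linarith
  have hW0 : ∀ l, 0 < specNorm (W l) := fun l =>
    (specNorm_nonneg _).lt_of_ne fun h => hc0.ne' (Finset.prod_eq_zero (Finset.mem_univ l) h.symm)
  have hd0 : (0 : ℝ) < d := Nat.cast_pos.2 hd
  have hd1 : (1 : ℝ) ≤ d := Nat.one_le_cast.2 hd
  have hh1 : (1 : ℝ) ≤ width d s := by
    have : 1 ≤ s d := by omega
    exact_mod_cast this.trans (le_width le_rfl)
  set h : ℝ := ((width d s : ℕ) : ℝ) with hh
  set V : Weights d s := fun l => (specNorm (W l))⁻¹ • W l with hV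
  have hVspec : ∀ l, specNorm (V l) = 1 := fun l => by
    rw [hV, specNorm_smul, abs_of_pos (inv_pos.2 (hW0 l)), inv_mul_cancel₀ (hW0 l).ne']
  have hWV : W = fun l => specNorm (W l) • V l := by
    ext1 l
    rw [hV, smul_smul, mul_inv_cancel₀ (hW0 l).ne', one_smul]
  have hnetW : ∀ x, net W x = c • net V x := fun x => by
    conv_lhs => rw [hWV]
    exact net_smul V x _ fun l => (hW0 l).le
  set F : ℝ := ∑ l, frobNorm (V l) ^ 2 with hF
  have hF1 : 1 ≤ F := by
    refine le_trans ?_ (Finset.single_le_sum (f := fun l => frobNorm (V l) ^ 2)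
      (fun l _ => sq_nonneg _) (Finset.mem_univ ⟨0, hd⟩))
    refine one_le_pow₀ ?_
    rw [← hVspec ⟨0, hd⟩]
    exact specNorm_le_frobNorm _
  have hΦ : spectralComplexity W = c ^ 2 * F := by
    rw [spectralComplexity, Finset.prod_pow, hF]
    congr 1
    refine Finset.sum_congr rfl fun l _ => ?_
    rw [hV, frobNorm_smul, mul_pow, sq_abs, inv_pow, div_eq_inv_mul]
  set Y := 2 * B * c / γ with hYdef
  have hY1 : 1 < Y := by rw [hYdef, lt_div_iff₀ hγ, one_mul]; exact hY
  -- The upper bound on `Y` makes the resolution fine enough for the margin; the lower bound keeps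
  -- the description short.
  obtain ⟨j, hj1, hj2⟩ := exists_nat_pow_near hY1.le (one_lt_two)
  set ε : ℝ := (2⁻¹ : ℝ) ^ j / (8 * d * h) with hε
  have hε0 : 0 < ε := by positivity
  set i : LatticeIndex d s := (j, fun l q => round (V l q.1 q.2 / ε)) with hi
  refine ⟨i, fun p hp => ?_, ?_⟩
  · have hpow : (2⁻¹ : ℝ) ^ j ≤ 1 := pow_le_one₀ (by norm_num) (by norm_num)
    have hpow0 : 0 < (2⁻¹ : ℝ) ^ j := by positivity
    -- Entries move by at most `ε / 2`, so the Frobenius norm of a layer moves by at most `ε h / 2 =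
    -- 2^(-j) / (16 d)`. Over `d` layers this totals `2^(-j) / 16`, and `e < 4` bounds the change of
    -- the scores by `B 2^(-j) / 4`.
    have hdiff : ∀ l, specNorm (latticeWeights i l - V l) ≤ 1 * ((2⁻¹ : ℝ) ^ j / 16 / d) := by
      intro l
      have hent : ∀ a b, |(latticeWeights i l - V l) a b| ≤ ε / 2 := fun a b => by
        have h1 : (latticeWeights i l - V l) a b
            = -(ε * (V l a b / ε - round (V l a b / ε))) := by
          rw [mul_sub, mul_div_cancel₀ _ hε0.ne', neg_sub]
          rfl
        rw [h1, abs_neg, abs_mul, abs_of_pos hε0]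
        calc ε * |V l a b / ε - round (V l a b / ε)| ≤ ε * (1 / 2) := by
              gcongr; exact abs_sub_round _
          _ = ε / 2 := by ring
      refine (specNorm_le_frobNorm _).trans ((frobNorm_le_of_abs_le (le_width (d := d) (by omega))
        (le_width (d := d) (by omega)) (by positivity) hent).trans_eq ?_)
      rw [← hh, hε]
      field_simp
      norm_num
    have hclose : ∀ k, |net (latticeWeights i) p.1 k - net V p.1 k| ≤ B * (2⁻¹ : ℝ) ^ j / 4 := by
      intro k
      have h1 := euclNorm_net_sub_le V (latticeWeights i) p.1 zero_le_one _
        (fun l => (hVspec l).le) (fun l => by positivity) hdiff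
      have hT : ∑ _l : Fin d, (2⁻¹ : ℝ) ^ j / 16 / d = (2⁻¹ : ℝ) ^ j / 16 := by
        rw [Finset.sum_const, Finset.card_univ, Fintype.card_fin, nsmul_eq_mul,
          mul_div_cancel₀ _ hd0.ne']
      rw [hT, one_pow, one_mul] at h1
      have h2 := exp_sub_one_le (t := (2⁻¹ : ℝ) ^ j / 16) (by positivity) (by linarith)
      have he := Real.exp_one_lt_d9
      have h3 : Real.exp ((2⁻¹ : ℝ) ^ j / 16) - 1 ≤ (2⁻¹ : ℝ) ^ j / 4 := by nlinarith
      calc |net (latticeWeights i) p.1 k - net V p.1 k|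
          ≤ (Real.exp ((2⁻¹ : ℝ) ^ j / 16) - 1) * ‖p.1‖ :=
            (abs_apply_le_euclNorm (net (latticeWeights i) p.1 - net V p.1) k).trans h1
        _ ≤ (2⁻¹ : ℝ) ^ j / 4 * B := by gcongr
        _ = B * (2⁻¹ : ℝ) ^ j / 4 := by ring
    have hmargin : B * (2⁻¹ : ℝ) ^ j ≤ γ / c := by
      have h1 : B * c / γ < 2 ^ j := by
        rw [pow_succ, hYdef] at hj2
        have : 2 * B * c / γ = B * c / γ * 2 := by ring
        linarith
      rw [inv_pow, ← div_eq_mul_inv, div_le_div_iff₀ (by positivity) hc0]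
      rw [div_lt_iff₀ hγ] at h1
      linarith
    rw [hnetW, marginLoss_smul hc0, marginLoss_smul hc0, zero_div]
    refine ⟨marginLoss_le_marginLoss hK hclose ?_ _, marginLoss_le_marginLoss hK
      (a := B * (2⁻¹ : ℝ) ^ j / 4) (fun k => by rw [abs_sub_comm]; exact hclose k) ?_ _⟩
    · linarith
    · change B * (2⁻¹ : ℝ) ^ j / 2 + 2 * (B * (2⁻¹ : ℝ) ^ j / 4) ≤ γ / c
      linarith
  · rw [hΦ]
    -- All factors of `Q` are at least 1, so `Q` dominates the cost of the resolution and the number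
    -- of weights. The total is `Q + Q + 2 * 256 Q = 514 Q`, and the claimed bound is `2056 * Q /
    -- 4`.
    set Q := Y ^ 2 * (d ^ 2 * h ^ 2 * F) with hQ
    have hQeq : B ^ 2 * d ^ 2 * h ^ 2 * (c ^ 2 * F) / γ ^ 2 = Q / 4 := by
      rw [hQ, hYdef]; ring
    have hdh : (1 : ℝ) ≤ d ^ 2 * h ^ 2 := one_le_mul_of_one_le_of_one_le (one_le_pow₀ hd1)
      (one_le_pow₀ hh1)
    have hY2 : 1 ≤ Y ^ 2 := one_le_pow₀ hY1.le
    have hjQ : ((j : ℝ) + 1) ≤ Q := by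
      have h1 : ((j + 1 : ℕ) : ℝ) ≤ 2 ^ j := by exact_mod_cast Nat.lt_two_pow_self (n := j)
      push_cast at h1
      calc (j : ℝ) + 1 ≤ Y := h1.trans hj1
        _ ≤ Y ^ 2 := by nlinarith
        _ ≤ Q := le_mul_of_one_le_right (by positivity) (one_le_mul_of_one_le_of_one_le hdh hF1)
    have hNQ : numWeights d s ≤ Q := by
      calc numWeights d s ≤ d * h ^ 2 := numWeights_le
        _ ≤ d ^ 2 * h ^ 2 := by gcongr; nlinarith
        _ ≤ d ^ 2 * h ^ 2 * F := le_mul_of_one_le_right (by positivity) hF1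
        _ ≤ Q := le_mul_of_one_le_left (by positivity) hY2
    have hkQ : ∑ l, ∑ q, (i.2 l q : ℝ) ^ 2 ≤ 256 * Q := by
      calc ∑ l, ∑ q, (i.2 l q : ℝ) ^ 2
          ≤ ∑ l : Fin d, ∑ q : LayerIndex s l, 4 * (V l q.1 q.2 / ε) ^ 2 :=
            Finset.sum_le_sum fun l _ => Finset.sum_le_sum fun q _ => round_sq_le _
        _ = 4 / ε ^ 2 * F := by
            rw [hF, Finset.mul_sum]
            refine Finset.sum_congr rfl fun l _ => ?_
            rw [frobNorm_sq, ← Fintype.sum_prod_type', Finset.mul_sum]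
            exact Finset.sum_congr rfl fun q _ => by rw [div_pow]; ring
        _ = 256 * ((2 ^ j) ^ 2 * (d ^ 2 * h ^ 2 * F)) := by
            rw [hε, inv_pow]
            field_simp
            norm_num
        _ ≤ 256 * Q := by rw [hQ]; gcongr
    rw [hQeq]
    change ((j : ℝ) + 1) + _ ≤ _
    linarith

/-- The generalization bound, uniformly over all weights. -/
theorem exists_forall_expectedLoss_le (hd : 0 < d) (hK : 2 ≤ s d) {B γ : ℝ} (hγ : 0 < γ)
    (D : Measure (EuclideanSpace ℝ (Fin (s 0)) × Fin (s d))) [IsProbabilityMeasure D]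
    (hD : ∀ᵐ p ∂D, ‖p.1‖ ≤ B) {m : ℕ} (hm : 0 < m) {δ : ℝ} (hδ : 0 < δ) :
    ∃ E : Set (Fin m → EuclideanSpace ℝ (Fin (s 0)) × Fin (s d)), MeasurableSet E ∧
      ENNReal.ofReal (1 - δ) ≤ Measure.pi (fun _ : Fin m => D) E ∧
      ∀ S ∈ E, ∀ W : Weights d s, expectedLoss D 0 W ≤ empiricalLoss S γ W +
        20000 * √((B ^ 2 * d ^ 2 * width d s ^ 2 * spectralComplexity W
          + max 1 (γ ^ 2) * Real.log (d * m / δ)) / (γ ^ 2 * m)) := by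
  rcases lt_or_ge 1 δ with hδ1 | hδ1
  · refine ⟨∅, MeasurableSet.empty, ?_, fun S hS => hS.elim⟩
    rw [ENNReal.ofReal_of_nonpos (by linarith)]
    exact zero_le
  have hm0 : (0 : ℝ) < m := Nat.cast_pos.2 hm
  obtain ⟨E, hE, hEδ, hES⟩ := exists_forall_integral_le_average_add D (latticePrior d s)
    latticePrior_singleton_ne_zero (f := latticeLoss B)
    (fun i => measurable_marginLoss_net _ _) (fun i p => marginLoss_mem_Icc _ _ _) hm hδ hδ1
  have hbdd : ∀ᵐ S ∂Measure.pi (fun _ : Fin m => D), ∀ k, ‖(S k).1‖ ≤ B :=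
    ae_all_iff.2 fun k => (Measure.quasiMeasurePreserving_eval (fun _ : Fin m => D) k).ae hD
  -- The lattice approximation only holds on inputs of norm at most `B`, so the sample itself must
  -- satisfy this bound; almost every sample does.
  refine ⟨E ∩ {S | ∀ k, ‖(S k).1‖ ≤ B}, hE.inter ?_, ?_, fun S hS W => ?_⟩
  · rw [Set.ofPred_forall]
    exact MeasurableSet.iInter fun k => measurableSet_le (by fun_prop) measurable_const
  · exact hEδ.trans (measure_mono_ae (hbdd.mono fun S hS hSE => ⟨hSE, hS⟩))
  obtain ⟨hSE, hSB⟩ := hS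
  have hint : ∀ (γ' : ℝ) (V : Weights d s), Integrable (fun p => marginLoss γ' (net V p.1) p.2) D :=
    fun γ' V => Integrable.of_mem_Icc 0 1 (measurable_marginLoss_net γ' V).aemeasurable
      (Filter.Eventually.of_forall fun p => marginLoss_mem_Icc _ _ _)
  rcases le_or_gt (2 * B * ∏ l, specNorm (W l)) γ with hY | hY
  · have h1 : empiricalLoss S γ W = 1 := by
      have : ∀ k, marginLoss γ (net W (S k).1) (S k).2 = 1 := fun k => by
        refine marginLoss_eq_one hK (fun y => ?_) _
        have hc : 0 ≤ ∏ l, specNorm (W l) := Finset.prod_nonneg fun l _ => specNorm_nonneg _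
        have := (abs_apply_le_euclNorm _ y).trans ((euclNorm_net_le W (S k).1).trans
          (mul_le_mul_of_nonneg_left (hSB k) hc))
        linarith
      simp [empiricalLoss, this, hm0.ne']
    have h2 : expectedLoss D 0 W ≤ 1 := by
      have := integral_mono (hint 0 W) (integrable_const 1) fun p => (marginLoss_mem_Icc _ _ _).2
      simpa [expectedLoss] using this
    rw [h1]
    exact h2.trans (le_add_of_nonneg_right (by positivity))
  · obtain ⟨i, hi, hlen⟩ := exists_latticeIndex hd hK hγ W hY
    have h1 : expectedLoss D 0 W ≤ ∫ p, latticeLoss B i p ∂D :=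
      integral_mono_ae (hint 0 W) (hint _ _) (hD.mono fun p hp => (hi p hp).1)
    have h2 : (∑ k, latticeLoss B i (S k)) / m ≤ empiricalLoss S γ W := by
      rw [empiricalLoss]
      gcongr with k
      exact (hi _ (hSB k)).2
    refine h1.trans ((hES S hSE i).trans (add_le_add h2 ?_))
    have hprior := neg_log_latticePrior_le i
    set Q := B ^ 2 * d ^ 2 * width d s ^ 2 * spectralComplexity W with hQ
    have hΦ0 : 0 ≤ spectralComplexity W :=
      mul_nonneg (Finset.prod_nonneg fun l _ => sq_nonneg _)
        (Finset.sum_nonneg fun l _ => div_nonneg (sq_nonneg _) (sq_nonneg _))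
    have hQ0 : 0 ≤ Q / γ ^ 2 := by positivity
    have hlog0 : 0 ≤ Real.log (1 / δ) := Real.log_nonneg (by rw [le_div_iff₀ hδ]; linarith)
    -- The union bound only costs `log (1 / δ)`; the factors `d m ≥ 1` and `max 1 (γ²) / γ² ≥ 1`
    -- give room.
    have hlog : Real.log (1 / δ) ≤ max 1 (γ ^ 2) / γ ^ 2 * Real.log (d * m / δ) := by
      have hdm : (1 : ℝ) ≤ d * m := by exact_mod_cast Nat.mul_pos hd hm
      have hmono : Real.log (1 / δ) ≤ Real.log (d * m / δ) := by
        refine Real.log_le_log (by positivity) ?_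
        gcongr
      refine hmono.trans (le_mul_of_one_le_left (hlog0.trans hmono) ?_)
      rw [le_div_iff₀ (by positivity), one_mul]
      exact le_max_right _ _
    rw [show (20000 : ℝ) = √(20000 ^ 2) by rw [Real.sqrt_sq (by norm_num)],
      ← Real.sqrt_mul (by norm_num)]
    refine Real.sqrt_le_sqrt ?_
    -- Here `800000000 = 2 * 20000²`, far more than the required 2056; the constant 20000 is
    -- dictated by part (a).
    have hrhs : (20000 : ℝ) ^ 2 * ((Q + max 1 (γ ^ 2) * Real.log (d * m / δ)) / (γ ^ 2 * m))
        = (800000000 * (Q / γ ^ 2 + max 1 (γ ^ 2) / γ ^ 2 * Real.log (d * m / δ))) / (2 * m) := by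
      field_simp
      ring
    rw [hrhs]
    gcongr
    linarith

end

end PacBayesNet

end

open PacBayesNet in
/-- PAC-Bayesian margin bound for ReLU networks with diagonal sensitivity matrices. `C` is an
absolute constant. The first part says that, for layers of equal spectral norm `β`, the sensitivity
matrices and the optimized posterior satisfy the perturbation condition and have small divergence
from the prior; the second part is the generalization bound, for all weights. -/
theorem theorem1 :
    ∃ C : ℝ, 0 < C ∧
      ∀ (d : ℕ) (s : ℕ → ℕ) (B γ : ℝ), 0 < d → 0 < γ → 0 ≤ B →
        (∀ (W : Weights d s) (β βhat : ℝ),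
          (∀ l, specNorm (W l) = β) → γ ≤ 2 * B * β ^ d → |β - βhat| ≤ β / d →
            (1 / 2 : ℝ≥0∞) ≤ perturbationLaw B γ (priorVar d s B γ βhat) W
                {u | blockNormSq (sensitivity B W) u < γ ^ 2 / 16 ∧
                  ∀ x : EuclideanSpace ℝ (Fin (s 0)), ‖x‖ ≤ B → ∀ j : Fin (s d),
                    |net (W + unvec u) x j - net W x j| ^ 2
                      ≤ blockNormSq (sensitivity B W) u} ∧
            klDiv (posterior B γ (priorVar d s B γ βhat) W) (prior d s (priorVar d s B γ βhat))
              ≤ ENNReal.ofReal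
                  (C * (B ^ 2 * d ^ 2 * width d s ^ 2 * spectralComplexity W / γ ^ 2))) ∧
        (2 ≤ s d →
          ∀ (D : Measure (EuclideanSpace ℝ (Fin (s 0)) × Fin (s d))) [IsProbabilityMeasure D],
            (∀ᵐ p ∂D, ‖p.1‖ ≤ B) →
            ∀ (m : ℕ) (δ : ℝ), 0 < m → 0 < δ →
              ∃ E : Set (Fin m → EuclideanSpace ℝ (Fin (s 0)) × Fin (s d)),
                MeasurableSet E ∧
                ENNReal.ofReal (1 - δ) ≤ Measure.pi (fun _ : Fin m => D) E ∧
                ∀ S ∈ E, ∀ W : Weights d s,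
                  expectedLoss D 0 W ≤ empiricalLoss S γ W +
                    C * √((B ^ 2 * d ^ 2 * width d s ^ 2 * spectralComplexity W
                            + max 1 (γ ^ 2) * Real.log (d * m / δ)) / (γ ^ 2 * m))) := by
  refine ⟨20000, by norm_num, fun d s B γ hd hγ _ => ⟨fun W β βhat hW hle hβ => ?_, ?_⟩⟩
  · exact perturbationLaw_and_klDiv_le hd hγ hW hle hβ
  · intro hK D _ hD m δ hm hδ
    exact exists_forall_expectedLoss_le hd hK hγ D hD hm hδ
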